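/- A \emph{vector addition tree automaton} (VATA) consists of a finite ranked alphabet $F$, a finite set $Q$ of states, a dimension $k\in\mathbb N$, a finite set of rules $$f(\langle q_1,x_1\rangle,\dots,\langle q_n,x_n\rangle)\to\langle q,(x_1-y_1)+\dots+(x_n-y_n)+z\rangle$$ with $f\in F$ of rank $n\ge 0$, $q_1,\dots,q_n,q\in Q$ and $y_1,\dots,y_n,z\in\mathbb N^k$, and a finite set $C\subseteq Q\times\mathbb N^k$ of accepting configurations. Configurations are elements of $Q\times\mathbb N^k$. If the terms $t_1,\dots,t_n$ reach $\langle q_1,x_1\rangle,\dots,\langle q_n,x_n\rangle$ and $x_i\ge y_i$ (componentwise) for all $i$, then by the rule above the term $f(t_1,\dots,t_n)$ reaches $\langle q,\sum_i (x_i-y_i)+z\rangle$. A term is accepted if it reaches some configuration in $C$, and the automaton is \emph{non-empty} if it accepts some term. Let $\mathrm C^2[\downarrow,\downarrow^+,\to,\to^+,\tau_{com}]$ be the two-variable fragment of first-order logic with equality, extended by the counting quantifiers $\exists^{\ge n}$, $\exists^{\le n}$ ($n\in\mathbb N$), over arbitrary unary symbols, the binary symbols $\downarrow,\downarrow^+,\to,\to^+$,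 and arbitrary further (``common'') binary symbols $\tau_{com}$. Its sentences are interpreted over finite, unranked, ordered, nonempty trees, in which $\downarrow$ is the child relation, $\to$ the right-sibling relation, and $\downarrow^+,\to^+$ are their transitive closures, while the unary and common binary symbols are interpreted arbitrarily. The \emph{satisfiability problem} asks whether a given sentence has such a model. \textbf{Theorem.} The satisfiability problem for $\mathrm C^2[\downarrow,\downarrow^+,\to,\to^+,\tau_{com}]$ is at least as hard as checking non-emptiness of vector addition tree automata: there is a function, computable in polynomial time (all numbers being written in unary), that maps every VATA $\mathcal A$ to a sentence $\varphi_{\mathcal A}$ of $\mathrm C^2[\downarrow,\downarrow^+,\to,\to^+,\tau_{com}]$ such that $\mathcal A$ is non-empty if and only if $\varphi_{\mathcal A}$ is satisfiable. -/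

import Mathlib

/-! ## Programs with a step count, polynomial-time reductions -/

/-- Programs of a machine with finitely many stacks (numbered registers) over an alphabet `Γ` and a
finite control.  A test looks at the top symbol of one stack (`none` if the stack is empty). -/
inductive Prog (Γ : Type) : Type where
  | skip : Prog Γ
  | push (r : ℕ) (a : Γ) : Prog Γ
  | pop (r : ℕ) : Prog Γ
  | seq (p q : Prog Γ) : Prog Γ
  | ite (r : ℕ) (test : Option Γ → Bool) (p q : Prog Γ) : Prog Γ
  | loop (r : ℕ) (test : Option Γ → Bool) (p : Prog Γ) : Prog Γ

/-- `p.Runs s s' t`: started with stack contents `s`, the program `p` halts with stack contents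
`s'` after exactly `t` steps.  Each elementary instruction and each test is one step. -/
inductive Prog.Runs {Γ : Type} : Prog Γ → (ℕ → List Γ) → (ℕ → List Γ) → ℕ → Prop where
  | skip (s : ℕ → List Γ) : Prog.Runs Prog.skip s s 1
  | push (r : ℕ) (a : Γ) (s : ℕ → List Γ) :
      Prog.Runs (Prog.push r a) s (Function.update s r (a :: s r)) 1
  | pop (r : ℕ) (s : ℕ → List Γ) :
      Prog.Runs (Prog.pop r) s (Function.update s r (s r).tail) 1
  | seq {p q : Prog Γ} {s s' s'' : ℕ → List Γ} {t t' : ℕ} :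
      Prog.Runs p s s' t → Prog.Runs q s' s'' t' → Prog.Runs (Prog.seq p q) s s'' (t + t')
  | ite_true {r : ℕ} {test : Option Γ → Bool} {p q : Prog Γ} {s s' : ℕ → List Γ} {t : ℕ} :
      test (s r).head? = true → Prog.Runs p s s' t →
      Prog.Runs (Prog.ite r test p q) s s' (t + 1)
  | ite_false {r : ℕ} {test : Option Γ → Bool} {p q : Prog Γ} {s s' : ℕ → List Γ} {t : ℕ} :
      test (s r).head? = false → Prog.Runs q s s' t →
      Prog.Runs (Prog.ite r test p q) s s' (t + 1)
  | loop_exit {r : ℕ} {test : Option Γ → Bool} {p : Prog Γ} {s : ℕ → List Γ} :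
      test (s r).head? = false → Prog.Runs (Prog.loop r test p) s s 1
  | loop_step {r : ℕ} {test : Option Γ → Bool} {p : Prog Γ} {s s' s'' : ℕ → List Γ} {t t' : ℕ} :
      test (s r).head? = true → Prog.Runs p s s' t →
      Prog.Runs (Prog.loop r test p) s' s'' t' →
      Prog.Runs (Prog.loop r test p) s s'' (t + t' + 1)

/-- Stack `0` holds the input word, all other stacks are empty. -/
def Prog.start {Γ : Type} (w : List Γ) : ℕ → List Γ := fun r => if r = 0 then w else []

/-- The function `f` is computable in polynomial time with respect to the encodings `ea`, `eb` of
its arguments and values by words over a finite alphabet. -/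
def PolyTimeComputable {Γ α β : Type} [Finite Γ] (ea : α → List Γ) (eb : β → List Γ)
    (f : α → β) : Prop :=
  ∃ (p : Prog Γ) (P : Polynomial ℕ), ∀ a : α, ∃ (s : ℕ → List Γ) (t : ℕ),
    p.Runs (Prog.start (ea a)) s t ∧ s 0 = eb (f a) ∧ t ≤ P.eval (ea a).length

/-- Polynomial-time many-one reducibility of the decision problem `A` (with instances in `α`,
encoded by `ea`) to the decision problem `B` (with instances in `β`, encoded by `eb`). -/
def PolyTimeReducible {Γ α β : Type} [Finite Γ] (ea : α → List Γ) (eb : β → List Γ)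
    (A : α → Prop) (B : β → Prop) : Prop :=
  ∃ f : α → β, PolyTimeComputable ea eb f ∧ ∀ a : α, A a ↔ B (f a)

/-! ## Vector addition tree automata -/

/-- Terms over a ranked alphabet with `m` symbols. -/
inductive RankedTerm {m : ℕ} (rank : Fin m → ℕ) : Type where
  | node (f : Fin m) (args : Fin (rank f) → RankedTerm rank) : RankedTerm rank

/-- A transition rule `f(⟨q₁, x₁⟩, …, ⟨qₙ, xₙ⟩) → ⟨q, (x₁ - y₁) + ⋯ + (xₙ - yₙ) + z⟩`, where
`f = symbol` has rank `n`, `qᵢ = source i`, `yᵢ = loss i`, `q = target` and `z = gain`. -/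
structure VATARule {m : ℕ} (rank : Fin m → ℕ) (numStates dim : ℕ) : Type where
  symbol : Fin m
  source : Fin (rank symbol) → Fin numStates
  loss : Fin (rank symbol) → Fin dim → ℕ
  target : Fin numStates
  gain : Fin dim → ℕ

/-- Vector addition tree automata: a finite ranked alphabet, a finite set of states, a dimension
(the number of counters), a finite set of rules, a finite set of accepting configurations. -/
structure VATA : Type where
  numSymbols : ℕ
  rank : Fin numSymbols → ℕ
  numStates : ℕ
  dim : ℕ
  rules : List (VATARule rank numStates dim)
  accepting : List (Fin numStates × (Fin dim → ℕ))

/-- `A.Reaches t q x`: some run of `A` on the term `t` ends in the configuration `⟨q, x⟩`.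
A rule may be applied only if no counter becomes negative in `xᵢ - yᵢ`. -/
inductive VATA.Reaches (A : VATA) :
    RankedTerm A.rank → Fin A.numStates → (Fin A.dim → ℕ) → Prop where
  | step (r : VATARule A.rank A.numStates A.dim) (hr : r ∈ A.rules)
      (ts : Fin (A.rank r.symbol) → RankedTerm A.rank)
      (xs : Fin (A.rank r.symbol) → Fin A.dim → ℕ)
      (hreach : ∀ i, VATA.Reaches A (ts i) (r.source i) (xs i))
      (hloss : ∀ i c, r.loss i c ≤ xs i c) :
      VATA.Reaches A (RankedTerm.node r.symbol ts) r.target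
        (fun c => (∑ i, (xs i c - r.loss i c)) + r.gain c)

/-- `A` accepts the term `t`. -/
def VATA.Accepts (A : VATA) (t : RankedTerm A.rank) : Prop :=
  ∃ c ∈ A.accepting, A.Reaches t c.1 c.2

/-- The automaton accepts at least one term. -/
def VATA.NonEmpty (A : VATA) : Prop := ∃ t : RankedTerm A.rank, A.Accepts t

/-! ## Two-variable logic with counting quantifiers over finite ordered trees -/

/-- The two variables. -/
inductive Var : Type where
  | x : Var
  | y : Var
  deriving DecidableEq

/-- The navigational symbols: child, descendant, right sibling, following sibling. -/
inductive Nav : Type where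
  | child : Nav
  | desc : Nav
  | next : Nav
  | foll : Nav

/-- Formulas of two-variable logic with counting quantifiers.  The unary symbols and the common
binary symbols are numbered. -/
inductive C2Formula : Type where
  | eq (u v : Var) : C2Formula
  | unary (n : ℕ) (u : Var) : C2Formula
  | nav (s : Nav) (u v : Var) : C2Formula
  | common (n : ℕ) (u v : Var) : C2Formula
  | not (φ : C2Formula) : C2Formula
  | and (φ ψ : C2Formula) : C2Formula
  | or (φ ψ : C2Formula) : C2Formula
  | ex (v : Var) (φ : C2Formula) : C2Formula
  | all (v : Var) (φ : C2Formula) : C2Formula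
  | atLeast (k : ℕ) (v : Var) (φ : C2Formula) : C2Formula
  | atMost (k : ℕ) (v : Var) (φ : C2Formula) : C2Formula

/-- The variable `w` occurs free in the formula. -/
def C2Formula.Free (w : Var) : C2Formula → Prop
  | .eq u v => w = u ∨ w = v
  | .unary _ u => w = u
  | .nav _ u v => w = u ∨ w = v
  | .common _ u v => w = u ∨ w = v
  | .not φ => φ.Free w
  | .and φ ψ => φ.Free w ∨ ψ.Free w
  | .or φ ψ => φ.Free w ∨ ψ.Free w
  | .ex v φ => w ≠ v ∧ φ.Free w
  | .all v φ => w ≠ v ∧ φ.Free w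
  | .atLeast _ v φ => w ≠ v ∧ φ.Free w
  | .atMost _ v φ => w ≠ v ∧ φ.Free w

/-- Formulas without free variables. -/
def C2Sentence : Type := {φ : C2Formula // ∀ w, ¬ φ.Free w}

/-- Finite unranked ordered trees with interpretations of the unary and of the common binary
symbols.  The nodes form a tree domain: `u ++ [i]` is the `i`-th child of `u`, counted from the
left and starting at `0`. -/
structure TreeStructure : Type where
  dom : Finset (List ℕ)
  root_mem : [] ∈ dom
  parent_mem : ∀ (u : List ℕ) (i : ℕ), u ++ [i] ∈ dom → u ∈ dom
  left_mem : ∀ (u : List ℕ) (i : ℕ), u ++ [i + 1] ∈ dom → u ++ [i] ∈ dom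
  unary : ℕ → dom → Prop
  common : ℕ → dom → dom → Prop

/-- `w` is a child of `u`. -/
def TreeStructure.Child (T : TreeStructure) (u w : T.dom) : Prop :=
  ∃ i : ℕ, w.1 = u.1 ++ [i]

/-- `w` is the right sibling of `u`. -/
def TreeStructure.Next (T : TreeStructure) (u w : T.dom) : Prop :=
  ∃ (p : List ℕ) (i : ℕ), u.1 = p ++ [i] ∧ w.1 = p ++ [i + 1]

/-- The fixed interpretation of the navigational symbols. -/
def TreeStructure.navRel (T : TreeStructure) : Nav → T.dom → T.dom → Prop
  | .child => T.Child
  | .desc => Relation.TransGen T.Child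
  | .next => T.Next
  | .foll => Relation.TransGen T.Next

/-- `T.Sat φ e`: the formula `φ` holds in `T` under the assignment `e`. -/
def TreeStructure.Sat (T : TreeStructure) : C2Formula → (Var → T.dom) → Prop
  | .eq u v, e => e u = e v
  | .unary n u, e => T.unary n (e u)
  | .nav s u v, e => T.navRel s (e u) (e v)
  | .common n u v, e => T.common n (e u) (e v)
  | .not φ, e => ¬ T.Sat φ e
  | .and φ ψ, e => T.Sat φ e ∧ T.Sat ψ e
  | .or φ ψ, e => T.Sat φ e ∨ T.Sat ψ e
  | .ex v φ, e => ∃ a, T.Sat φ (Function.update e v a)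
  | .all v φ, e => ∀ a, T.Sat φ (Function.update e v a)
  | .atLeast k v φ, e => k ≤ Set.ncard {a | T.Sat φ (Function.update e v a)}
  | .atMost k v φ, e => Set.ncard {a | T.Sat φ (Function.update e v a)} ≤ k

/-- The sentence has a finite tree model. -/
def C2Sentence.Satisfiable (φ : C2Sentence) : Prop :=
  ∃ T : TreeStructure, ∀ e : Var → T.dom, T.Sat φ.1 e

/-! ## Encodings by words -/

/-- The finite alphabet of the encodings. -/
inductive CodeSym : Type where
  | tick | endNum | item | endList
  | varX | varY | eq | unary | child | desc | next | foll | common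
  | not | and | or | ex | all | atLeast | atMost

instance : Finite CodeSym :=
  Finite.of_injective (fun a : CodeSym => (⟨a.ctorIdx, by cases a <;> decide⟩ : Fin 20)) (by
    intro a b h
    cases a <;> cases b <;> first | rfl | exact absurd h (by decide))

/-- Natural numbers are written in unary. -/
def encNat (n : ℕ) : List CodeSym := List.replicate n CodeSym.tick ++ [CodeSym.endNum]

def encList {α : Type} (e : α → List CodeSym) : List α → List CodeSym
  | [] => [CodeSym.endList]
  | a :: l => CodeSym.item :: (e a ++ encList e l)

def encFun {α : Type} {n : ℕ} (e : α → List CodeSym) (v : Fin n → α) : List CodeSym :=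
  encList e (List.ofFn v)

def encFin {n : ℕ} (i : Fin n) : List CodeSym := encNat i

def VATARule.encode {m : ℕ} {rank : Fin m → ℕ} {numStates dim : ℕ}
    (r : VATARule rank numStates dim) : List CodeSym :=
  encFin r.symbol ++ (encFun encFin r.source ++ (encFun (encFun encNat) r.loss ++
    (encFin r.target ++ encFun encNat r.gain)))

def VATA.encode (A : VATA) : List CodeSym :=
  encFun encNat A.rank ++ (encNat A.numStates ++ (encNat A.dim ++
    (encList VATARule.encode A.rules ++
      encList (fun c => encFin c.1 ++ encFun encNat c.2) A.accepting)))

def Var.encode : Var → CodeSym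
  | .x => CodeSym.varX
  | .y => CodeSym.varY

def Nav.encode : Nav → CodeSym
  | .child => CodeSym.child
  | .desc => CodeSym.desc
  | .next => CodeSym.next
  | .foll => CodeSym.foll

/-- Prefix notation. -/
def C2Formula.encode : C2Formula → List CodeSym
  | .eq u v => [CodeSym.eq, u.encode, v.encode]
  | .unary n u => CodeSym.unary :: u.encode :: encNat n
  | .nav s u v => [s.encode, u.encode, v.encode]
  | .common n u v => CodeSym.common :: u.encode :: v.encode :: encNat n
  | .not φ => CodeSym.not :: φ.encode
  | .and φ ψ => CodeSym.and :: (φ.encode ++ ψ.encode)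
  | .or φ ψ => CodeSym.or :: (φ.encode ++ ψ.encode)
  | .ex v φ => CodeSym.ex :: v.encode :: φ.encode
  | .all v φ => CodeSym.all :: v.encode :: φ.encode
  | .atLeast k v φ => CodeSym.atLeast :: v.encode :: (encNat k ++ φ.encode)
  | .atMost k v φ => CodeSym.atMost :: v.encode :: (encNat k ++ φ.encode)

def C2Sentence.encode (φ : C2Sentence) : List CodeSym := φ.1.encode

/-! The encodings are unambiguous. -/

/-- The code words determine the encoded objects, also when followed by further symbols. -/
def PrefixCode {α : Type} (e : α → List CodeSym) : Prop :=
  ∀ (a b : α) (s t : List CodeSym), e a ++ s = e b ++ t → a = b ∧ s = t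

theorem prefixCode_encNat : PrefixCode encNat := by
  intro a
  induction a with
  | zero =>
    intro b s t h
    cases b <;> simp_all [encNat, List.replicate_succ]
  | succ a ih =>
    intro b s t h
    cases b with
    | zero => simp [encNat, List.replicate_succ] at h
    | succ b =>
      have := ih b s t (by simpa [encNat, List.replicate_succ] using h)
      simpa using this

theorem prefixCode_encFin {n : ℕ} : PrefixCode (encFin (n := n)) := by
  intro a b s t h
  obtain ⟨h1, h2⟩ := prefixCode_encNat a b s t h
  exact ⟨Fin.ext h1, h2⟩

theorem prefixCode_encList {α : Type} {e : α → List CodeSym} (he : PrefixCode e) :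
    PrefixCode (encList e) := by
  intro a
  induction a with
  | nil =>
    intro b s t h
    cases b <;> simp_all [encList]
  | cons a l ih =>
    intro b s t h
    cases b with
    | nil => simp [encList] at h
    | cons b l' =>
      simp only [encList, List.cons_append, List.append_assoc, List.cons.injEq, true_and] at h
      obtain ⟨h1, h2⟩ := he _ _ _ _ h
      obtain ⟨h3, h4⟩ := ih _ _ _ h2
      exact ⟨by rw [h1, h3], h4⟩

theorem prefixCode_encFun {α : Type} {n : ℕ} {e : α → List CodeSym} (he : PrefixCode e) :
    PrefixCode (encFun e (n := n)) := by
  intro a b s t h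
  obtain ⟨h1, h2⟩ := prefixCode_encList he _ _ _ _ h
  exact ⟨List.ofFn_injective h1, h2⟩

theorem prefixCode_rule {m : ℕ} {rank : Fin m → ℕ} {k d : ℕ} :
    PrefixCode (VATARule.encode (rank := rank) (numStates := k) (dim := d)) := by
  rintro ⟨f, q, y, q', z⟩ ⟨f', p, u, p', w⟩ s t h
  simp only [VATARule.encode, List.append_assoc] at h
  obtain ⟨rfl, h1⟩ := prefixCode_encFin _ _ _ _ h
  obtain ⟨rfl, h2⟩ := prefixCode_encFun prefixCode_encFin _ _ _ _ h1
  obtain ⟨rfl, h3⟩ := prefixCode_encFun (prefixCode_encFun prefixCode_encNat) _ _ _ _ h2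
  obtain ⟨rfl, h4⟩ := prefixCode_encFin _ _ _ _ h3
  obtain ⟨rfl, h5⟩ := prefixCode_encFun prefixCode_encNat _ _ _ _ h4
  exact ⟨rfl, h5⟩

theorem VATA.encode_injective : Function.Injective VATA.encode := by
  rintro ⟨m, rk, k, d, R, C⟩ ⟨m', rk', k', d', R', C'⟩ h
  simp only [VATA.encode] at h
  obtain ⟨h1, h⟩ := prefixCode_encList prefixCode_encNat _ _ _ _ h
  have hm : m = m' := by simpa using congrArg List.length h1
  subst hm
  obtain rfl := List.ofFn_injective h1
  obtain ⟨rfl, h⟩ := prefixCode_encNat _ _ _ _ h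
  obtain ⟨rfl, h⟩ := prefixCode_encNat _ _ _ _ h
  obtain ⟨rfl, h⟩ := prefixCode_encList prefixCode_rule _ _ _ _ h
  have hc : PrefixCode (fun c : Fin k × (Fin d → ℕ) => encFin c.1 ++ encFun encNat c.2) := by
    rintro ⟨a, v⟩ ⟨b, w⟩ s t h
    simp only [List.append_assoc] at h
    obtain ⟨rfl, h1⟩ := prefixCode_encFin _ _ _ _ h
    obtain ⟨rfl, h2⟩ := prefixCode_encFun prefixCode_encNat _ _ _ _ h1
    exact ⟨rfl, h2⟩
  obtain ⟨rfl, -⟩ := prefixCode_encList hc C C' [] [] (by simpa using h)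
  rfl

theorem Var.encode_injective : Function.Injective Var.encode := by
  intro u v h
  cases u <;> cases v <;> simp_all [Var.encode]

theorem Nav.encode_injective : Function.Injective Nav.encode := by
  intro u v h
  cases u <;> cases v <;> simp_all [Nav.encode]

theorem prefixCode_formula : PrefixCode C2Formula.encode := by
  intro a
  induction a with
  | eq u v =>
    intro b s t h
    cases b with
    | nav n _ _ => cases n <;> simp [C2Formula.encode, Nav.encode] at h
    | eq _ _ => simpa [C2Formula.encode, Var.encode_injective.eq_iff, and_assoc] using h
    | _ => simp [C2Formula.encode] at h
  | unary n u =>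
    intro b s t h
    cases b with
    | nav n _ _ => cases n <;> simp [C2Formula.encode, Nav.encode] at h
    | unary m v =>
      simp only [C2Formula.encode, List.cons_append, List.cons.injEq, true_and] at h
      obtain ⟨h1, h2⟩ := prefixCode_encNat _ _ _ _ h.2
      exact ⟨by rw [h1, Var.encode_injective h.1], h2⟩
    | _ => simp [C2Formula.encode] at h
  | nav n u v =>
    intro b s t h
    cases b with
    | nav _ _ _ =>
      simpa [C2Formula.encode, Var.encode_injective.eq_iff, Nav.encode_injective.eq_iff,
        and_assoc] using h
    | _ => cases n <;> simp [C2Formula.encode, Nav.encode] at h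
  | common n u v =>
    intro b s t h
    cases b with
    | nav n _ _ => cases n <;> simp [C2Formula.encode, Nav.encode] at h
    | common m u' v' =>
      simp only [C2Formula.encode, List.cons_append, List.cons.injEq, true_and] at h
      obtain ⟨h1, h2⟩ := prefixCode_encNat _ _ _ _ h.2.2
      exact ⟨by rw [h1, Var.encode_injective h.1, Var.encode_injective h.2.1], h2⟩
    | _ => simp [C2Formula.encode] at h
  | not φ ih =>
    intro b s t h
    cases b with
    | nav n _ _ => cases n <;> simp [C2Formula.encode, Nav.encode] at h
    | not ψ =>
      simp only [C2Formula.encode, List.cons_append, List.cons.injEq, true_and] at h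
      obtain ⟨h1, h2⟩ := ih _ _ _ h
      exact ⟨by rw [h1], h2⟩
    | _ => simp [C2Formula.encode] at h
  | and φ ψ ih ih' =>
    intro b s t h
    cases b with
    | nav n _ _ => cases n <;> simp [C2Formula.encode, Nav.encode] at h
    | and _ _ =>
      simp only [C2Formula.encode, List.cons_append, List.append_assoc, List.cons.injEq,
        true_and] at h
      obtain ⟨h1, h2⟩ := ih _ _ _ h
      obtain ⟨h3, h4⟩ := ih' _ _ _ h2
      exact ⟨by rw [h1, h3], h4⟩
    | _ => simp [C2Formula.encode] at h
  | or φ ψ ih ih' =>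
    intro b s t h
    cases b with
    | nav n _ _ => cases n <;> simp [C2Formula.encode, Nav.encode] at h
    | or _ _ =>
      simp only [C2Formula.encode, List.cons_append, List.append_assoc, List.cons.injEq,
        true_and] at h
      obtain ⟨h1, h2⟩ := ih _ _ _ h
      obtain ⟨h3, h4⟩ := ih' _ _ _ h2
      exact ⟨by rw [h1, h3], h4⟩
    | _ => simp [C2Formula.encode] at h
  | ex v φ ih =>
    intro b s t h
    cases b with
    | nav n _ _ => cases n <;> simp [C2Formula.encode, Nav.encode] at h
    | ex _ _ =>
      simp only [C2Formula.encode, List.cons_append, List.cons.injEq, true_and] at h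
      obtain ⟨h1, h2⟩ := ih _ _ _ h.2
      exact ⟨by rw [h1, Var.encode_injective h.1], h2⟩
    | _ => simp [C2Formula.encode] at h
  | all v φ ih =>
    intro b s t h
    cases b with
    | nav n _ _ => cases n <;> simp [C2Formula.encode, Nav.encode] at h
    | all _ _ =>
      simp only [C2Formula.encode, List.cons_append, List.cons.injEq, true_and] at h
      obtain ⟨h1, h2⟩ := ih _ _ _ h.2
      exact ⟨by rw [h1, Var.encode_injective h.1], h2⟩
    | _ => simp [C2Formula.encode] at h
  | atLeast k v φ ih =>
    intro b s t h
    cases b with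
    | nav n _ _ => cases n <;> simp [C2Formula.encode, Nav.encode] at h
    | atLeast _ _ _ =>
      simp only [C2Formula.encode, List.cons_append, List.append_assoc, List.cons.injEq,
        true_and] at h
      obtain ⟨h1, h2⟩ := prefixCode_encNat _ _ _ _ h.2
      obtain ⟨h3, h4⟩ := ih _ _ _ h2
      exact ⟨by rw [h1, h3, Var.encode_injective h.1], h4⟩
    | _ => simp [C2Formula.encode] at h
  | atMost k v φ ih =>
    intro b s t h
    cases b with
    | nav n _ _ => cases n <;> simp [C2Formula.encode, Nav.encode] at h
    | atMost _ _ _ =>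
      simp only [C2Formula.encode, List.cons_append, List.append_assoc, List.cons.injEq,
        true_and] at h
      obtain ⟨h1, h2⟩ := prefixCode_encNat _ _ _ _ h.2
      obtain ⟨h3, h4⟩ := ih _ _ _ h2
      exact ⟨by rw [h1, h3, Var.encode_injective h.1], h4⟩
    | _ => simp [C2Formula.encode] at h

theorem C2Sentence.encode_injective : Function.Injective C2Sentence.encode := by
  intro φ ψ h
  exact Subtype.ext (prefixCode_formula φ.1 ψ.1 [] [] (by simpa [C2Sentence.encode] using h)).1

/-!
A run of the automaton is written as a tree in which every configuration is represented in unary by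
leaves. A run node carries a rule; the children produced by it are the run nodes of the arguments,
as many leaves of kind `1` as the number of the target state, and one leaf of kind `c + 2` for each
unit that the rule adds to the counter `c`. The common relation sends each leaf to the run node at
which it is *consumed*, which must be an ancestor. A unit of a counter is consumed at the argument
from which a rule further up subtracts it, so the value of the counter at a node is the number of
leaves below it that are consumed at that node or above. This value never has to be mentioned: it
is nonnegative by definition, and the local numbers of attached and of consumed leaves determine
how it changes. The formula only prescribes these local numbers, by counting quantifiers whose
bounds are numbers of the automaton.

Conversely a run is turned into such a tree by induction, with the tokens pending at the root
scheduled for consumption at prescribed heights above it.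

The formula is written by a program that copies its input; since it repeats, for each entry of the
automaton, a text of linear length, its length is quadratic and so is the running time.
-/

/-! ## The formula of an automaton -/

namespace C2Formula

/-- The quantifier `∃^{=k}`. -/
def exactly (k : ℕ) (v : Var) (φ : C2Formula) : C2Formula :=
  .and (.atLeast k v φ) (.atMost k v φ)

/-- `u` is a run node, that is, it carries the unary symbol `0`.  Run nodes correspond to the nodes
of an accepted term; all other nodes are leaves that hold the state (unary symbol `1`) or a token of
the counter `c` (unary symbol `c + 2`) of their parent. -/
def run (u : Var) : C2Formula :=
  .unary 0 u

/-- `v` is a leaf of kind `s` attached to `u`. -/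
def attached (u v : Var) (s : ℕ) : C2Formula :=
  .and (.nav .child u v) (.and (.not (run v)) (.unary s v))

/-- `v` is a node of kind `s` consumed at `u`; the common symbol `0` maps a leaf to the run node
at which it is consumed. -/
def consumed (u v : Var) (s : ℕ) : C2Formula :=
  .and (.common 0 v u) (.unary s v)

/-- Exactly `l c` tokens of each counter `c` are consumed at `u`. -/
def consumption {d : ℕ} (u v : Var) (l : Fin d → ℕ) : C2Formula :=
  (List.ofFn fun c => exactly (l c) v (consumed u v (c + 2))).foldr .and (.eq u u)

/-- `φ` holds for the `i`-th child `y` of `x`, and this child is a run node. -/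
def argument (i : ℕ) (φ : C2Formula) : C2Formula :=
  .ex .y (.and (.nav .child .x .y) (.and (run .y)
    (.and (exactly i .x (.nav .foll .x .y)) φ)))

end C2Formula

namespace VATARule

variable {m k d : ℕ} {rank : Fin m → ℕ}

open C2Formula in
/-- The rule `r` is applied at the run node `x`. -/
def formula (r : VATARule rank k d) : C2Formula :=
  .and ((List.ofFn fun i => argument i (exactly (r.source i) .x (attached .y .x 1))).foldr .and
      (exactly (rank r.symbol) .y (.and (.nav .child .x .y) (run .y))))
    (.and ((List.ofFn fun i => argument i (consumption .y .x (r.loss i))).foldr .and (.eq .x .x))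
      (.and (exactly r.target .y (attached .x .y 1))
        ((List.ofFn fun c => exactly (r.gain c) .y (attached .x .y (c + 2))).foldr .and
          (.eq .x .x))))

end VATARule

namespace C2Formula

/-- The run node `x` is left with the configuration `⟨q, l⟩`. -/
def configuration {k d : ℕ} (q : Fin k) (l : Fin d → ℕ) : C2Formula :=
  .and (exactly q .y (attached .x .y 1)) (consumption .x .y l)

end C2Formula

namespace VATA

open C2Formula in
/-- The models of this formula are the accepting runs of `A`: all inner nodes are run nodes, every
leaf is consumed at exactly one of its ancestors, a rule is applied at every run node, and
the configuration reached at the root is accepting. -/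
def formula (A : VATA) : C2Formula :=
  .and (.all .x (.all .y (.or (.not (.nav .child .x .y)) (run .x))))
    (.and (.all .x (.all .y (.or (.not (.common 0 .x .y))
        (.and (.not (run .x)) (.nav .desc .y .x)))))
      (.and (.all .x (.or (run .x) (exactly 1 .y (.common 0 .x .y))))
        (.and (.all .x (.or (.not (run .x))
            ((A.rules.map VATARule.formula).foldr .or (.not (.eq .x .x)))))
          (.ex .x (.and (run .x) (.and (.not (.ex .y (.nav .child .y .x)))
            ((A.accepting.map fun a => configuration a.1 a.2).foldr .or
              (.not (.eq .x .x)))))))))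

end VATA

namespace C2Formula

variable {w u v : Var} {φ ψ : C2Formula}

theorem free_foldr_and {l : List C2Formula} :
    (l.foldr .and φ).Free w ↔ φ.Free w ∨ ∃ ψ ∈ l, ψ.Free w := by
  induction l with
  | nil => simp
  | cons ψ l ih => simp [Free, ih, or_left_comm]

theorem free_foldr_or {l : List C2Formula} :
    (l.foldr .or φ).Free w ↔ φ.Free w ∨ ∃ ψ ∈ l, ψ.Free w := by
  induction l with
  | nil => simp
  | cons ψ l ih => simp [Free, ih, or_left_comm]

theorem free_exactly {k : ℕ} : (exactly k v φ).Free w ↔ w ≠ v ∧ φ.Free w := by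
  simp [exactly, Free]

theorem eq_or_eq_of_free_attached {s : ℕ} (h : (attached u v s).Free w) : w = u ∨ w = v := by
  simp only [attached, run, Free] at h
  tauto

theorem eq_of_free_consumption {d : ℕ} {l : Fin d → ℕ} (h : (consumption u v l).Free w) :
    w = u := by
  rw [consumption, free_foldr_and] at h
  simp only [Free, List.mem_ofFn, exists_exists_eq_and, free_exactly, consumed] at h
  tauto

theorem eq_of_free_argument {i : ℕ} (hφ : φ.Free w → w = .x ∨ w = .y)
    (h : (argument i φ).Free w) : w = .x := by
  simp only [argument, run, free_exactly, Free] at h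
  tauto

theorem eq_of_free_configuration {k d : ℕ} {q : Fin k} {l : Fin d → ℕ}
    (h : (configuration q l).Free w) : w = .x := by
  rcases h with h | h
  · obtain ⟨hw, h⟩ := free_exactly.1 h
    exact (eq_or_eq_of_free_attached h).resolve_right hw
  · exact eq_of_free_consumption h

end C2Formula

open C2Formula in
theorem VATARule.eq_of_free_formula {m k d : ℕ} {rank : Fin m → ℕ} {r : VATARule rank k d} {w : Var}
    (h : r.formula.Free w) : w = .x := by
  have attached_x {s : ℕ} (hw : w ≠ .y) (h : (attached .x .y s).Free w) : w = .x :=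
    (eq_or_eq_of_free_attached h).resolve_right hw
  simp only [formula, C2Formula.Free, free_foldr_and, List.mem_ofFn, exists_exists_eq_and,
    free_exactly, or_self] at h
  rcases h with (h | ⟨i, h⟩) | (h | ⟨i, h⟩) | h | h | ⟨c, h⟩
  · simp only [run, C2Formula.Free] at h
    tauto
  · refine eq_of_free_argument (fun h => ?_) h
    obtain ⟨-, h⟩ := free_exactly.1 h
    exact (eq_or_eq_of_free_attached h).symm
  · exact h
  · exact eq_of_free_argument (fun h => .inr (eq_of_free_consumption h)) h
  · exact attached_x h.1 h.2
  · exact h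
  · exact attached_x h.1 h.2

namespace VATA

open C2Formula in
theorem not_free_formula (A : VATA) (w : Var) : ¬ A.formula.Free w := by
  have not_free_disj {α : Type} {l : List α} {F : α → C2Formula}
      (hF : ∀ a, (F a).Free w → w = .x) (hw : w ≠ .x) :
      ¬ C2Formula.Free w ((l.map F).foldr .or (.not (.eq .x .x))) := by
    simp only [free_foldr_or, Free, or_self, List.mem_map, exists_exists_and_eq_and]
    rintro (h | ⟨a, -, h⟩)
    exacts [hw h, hw (hF a h)]
  have rules := not_free_disj (l := A.rules) (F := VATARule.formula)
    fun _ => VATARule.eq_of_free_formula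
  have accepting := not_free_disj (l := A.accepting) (F := fun a => configuration a.1 a.2)
    fun _ => eq_of_free_configuration
  simp only [formula, run, C2Formula.Free, free_exactly]
  tauto

/-- The sentence `φ_A` of the reduction. -/
def sentence (A : VATA) : C2Sentence :=
  ⟨A.formula, A.not_free_formula⟩

end VATA

/-! ## Programs that run in linear time -/

namespace Prog

section RunsWithin

variable {Γ : Type} {p q : Prog Γ} {s s' s'' : ℕ → List Γ} {t t' r : ℕ}
  {test : Option Γ → Bool}

/-- `p` leads from the stacks `s` to the stacks `s'` in at most `t` steps. -/
def RunsWithin (p : Prog Γ) (s s' : ℕ → List Γ) (t : ℕ) : Prop :=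
  ∃ t' ≤ t, p.Runs s s' t'

theorem RunsWithin.mono (h : p.RunsWithin s s' t) (ht : t ≤ t') : p.RunsWithin s s' t' :=
  let ⟨n, hn, h⟩ := h
  ⟨n, hn.trans ht, h⟩

theorem runsWithin_skip (s : ℕ → List Γ) : skip.RunsWithin s s 1 :=
  ⟨1, le_rfl, .skip s⟩

theorem runsWithin_push (r : ℕ) (a : Γ) (s : ℕ → List Γ) :
    (push r a).RunsWithin s (Function.update s r (a :: s r)) 1 :=
  ⟨1, le_rfl, .push r a s⟩

theorem runsWithin_pop (r : ℕ) (s : ℕ → List Γ) :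
    (pop r).RunsWithin s (Function.update s r (s r).tail) 1 :=
  ⟨1, le_rfl, .pop r s⟩

theorem RunsWithin.seq (hp : p.RunsWithin s s' t) (hq : q.RunsWithin s' s'' t') :
    (p.seq q).RunsWithin s s'' (t + t') :=
  let ⟨_, hn, hp⟩ := hp
  let ⟨_, hn', hq⟩ := hq
  ⟨_, add_le_add hn hn', hp.seq hq⟩

theorem RunsWithin.ite_true (htest : test (s r).head? = true) (hp : p.RunsWithin s s' t) :
    (ite r test p q).RunsWithin s s' (t + 1) :=
  let ⟨_, hn, hp⟩ := hp
  ⟨_, Nat.succ_le_succ hn, .ite_true htest hp⟩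

theorem RunsWithin.ite_false (htest : test (s r).head? = false) (hq : q.RunsWithin s s' t) :
    (ite r test p q).RunsWithin s s' (t + 1) :=
  let ⟨_, hn, hq⟩ := hq
  ⟨_, Nat.succ_le_succ hn, .ite_false htest hq⟩

theorem runsWithin_loop_exit (htest : test (s r).head? = false) :
    (loop r test p).RunsWithin s s 1 :=
  ⟨1, le_rfl, .loop_exit htest⟩

theorem RunsWithin.loop_step (htest : test (s r).head? = true) (hp : p.RunsWithin s s' t)
    (hloop : (loop r test p).RunsWithin s' s'' t') :
    (loop r test p).RunsWithin s s'' (t + t' + 1) :=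
  let ⟨_, hn, hp⟩ := hp
  let ⟨_, hn', hloop⟩ := hloop
  ⟨_, Nat.succ_le_succ (add_le_add hn hn'), .loop_step htest hp hloop⟩

theorem runsWithin_loop {s : ℕ → ℕ → List Γ} {n : ℕ}
    (hp : ∀ i < n, test (s i r).head? = true ∧ p.RunsWithin (s i) (s (i + 1)) t)
    (hn : test (s n r).head? = false) :
    (loop r test p).RunsWithin (s 0) (s n) (n * (t + 1) + 1) := by
  induction n generalizing s with
  | zero => simpa using runsWithin_loop_exit hn
  | succ n ih =>
    obtain ⟨htest, hfirst⟩ := hp 0 n.succ_pos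
    have hrest := ih (s := fun i => s (i + 1)) (fun i hi => hp (i + 1) (Nat.succ_lt_succ hi)) hn
    exact (hfirst.loop_step htest hrest).mono (by ring_nf; rfl)

/-- The number of instructions and tests in a program. -/
def size : Prog Γ → ℕ
  | skip | push _ _ | pop _ => 1
  | seq p q => p.size + q.size
  | ite _ _ p q => p.size + q.size + 1
  | loop _ _ p => p.size + 1

end RunsWithin

end Prog

/-- The counters of the reduction: the number read last, the index of a counter of the automaton,
the index of an argument of a rule, and an auxiliary counter for copying. -/
inductive Counter : Type where
  | number | kind | index | scratch
  deriving DecidableEq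

/-- The stack that holds a counter. -/
def Counter.stack : Counter → ℕ
  | .number => 2
  | .kind => 3
  | .index => 4
  | .scratch => 5

/-- The input on stack `0`, the output (whose last symbol is on top) on stack `1`, and the
counters `c` in unary. -/
def memory (inp out : List CodeSym) (c : Counter → ℕ) : ℕ → List CodeSym
  | 0 => inp
  | 1 => out.reverse
  | 2 => .replicate (c .number) .tick
  | 3 => .replicate (c .kind) .tick
  | 4 => .replicate (c .index) .tick
  | 5 => .replicate (c .scratch) .tick
  | _ => []

section memory

variable {inp out : List CodeSym} {c : Counter → ℕ}

theorem memory_stack (r : Counter) : memory inp out c r.stack = .replicate (c r) .tick := by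
  cases r <;> rfl

theorem update_memory_zero (inp' : List CodeSym) :
    Function.update (memory inp out c) 0 inp' = memory inp' out c := by
  funext i
  rcases i with _ | _ | _ | _ | _ | _ | i <;> rfl

theorem update_memory_one (a : CodeSym) :
    Function.update (memory inp out c) 1 (a :: memory inp out c 1) =
      memory inp (out ++ [a]) c := by
  funext i
  rcases i with _ | _ | _ | _ | _ | _ | i
  case succ.zero => simp [memory]
  all_goals rfl

theorem update_memory_stack (r : Counter) (n : ℕ) :
    Function.update (memory inp out c) r.stack (.replicate n .tick) =
      memory inp out (Function.update c r n) := by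
  funext i
  by_cases hi : i = r.stack
  · simp [hi, memory_stack]
  · rw [Function.update_of_ne hi]
    cases r <;> rcases i with _ | _ | _ | _ | _ | _ | i <;>
      simp_all [memory, Counter.stack, Function.update_of_ne]

theorem runsWithin_pop_counter (r : Counter) :
    (Prog.pop r.stack).RunsWithin (memory inp out c)
      (memory inp out (Function.update c r (c r - 1))) 1 := by
  simpa only [memory_stack, List.tail_replicate, update_memory_stack] using
    Prog.runsWithin_pop r.stack (memory inp out c)

theorem runsWithin_push_counter (r : Counter) :
    (Prog.push r.stack .tick).RunsWithin (memory inp out c)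
      (memory inp out (Function.update c r (c r + 1))) 1 := by
  simpa only [memory_stack, ← List.replicate_succ, update_memory_stack] using
    Prog.runsWithin_push r.stack CodeSym.tick (memory inp out c)

theorem runsWithin_pop_input (a : CodeSym) :
    (Prog.pop 0).RunsWithin (memory (a :: inp) out c) (memory inp out c) 1 := by
  simpa only [memory, List.tail_cons, update_memory_zero] using
    Prog.runsWithin_pop 0 (memory (a :: inp) out c)

theorem runsWithin_push_output (a : CodeSym) :
    (Prog.push 1 a).RunsWithin (memory inp out c) (memory inp (out ++ [a]) c) 1 := by
  simpa only [update_memory_one] using Prog.runsWithin_push 1 a (memory inp out c)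

end memory

namespace Prog

/-- `p` reads `u`, writes `w` and changes the counters from `c` to `c'`, in time linear in the
number of symbols read or written. -/
def Translates (p : Prog CodeSym) (c c' : Counter → ℕ) (u w : List CodeSym) : Prop :=
  ∀ inp out, p.RunsWithin (memory (u ++ inp) out c) (memory inp (out ++ w) c')
    (p.size * (u.length + w.length + 1))

variable {p q : Prog CodeSym} {c c' c'' : Counter → ℕ} {u u' w w' : List CodeSym}

theorem Translates.seq (hp : p.Translates c c' u w) (hq : q.Translates c' c'' u' w') :
    (p.seq q).Translates c c'' (u ++ u') (w ++ w') := by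
  intro inp out
  have h := (hp (u' ++ inp) out).seq (hq inp (out ++ w))
  simp only [← List.append_assoc] at h ⊢
  refine h.mono ?_
  simp only [size, List.length_append, add_mul]
  gcongr <;> omega

theorem translates_pushCounter (c : Counter → ℕ) (r : Counter) :
    (push r.stack .tick).Translates c (Function.update c r (c r + 1)) [] [] := by
  intro inp out
  simpa [size] using runsWithin_push_counter r

/-- Writes the word `w`. -/
def emit : List CodeSym → Prog CodeSym
  | [] => skip
  | a :: w => seq (push 1 a) (emit w)

theorem runsWithin_emit (w inp out : List CodeSym) :
    (emit w).RunsWithin (memory inp out c) (memory inp (out ++ w) c) (emit w).size := by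
  induction w generalizing out with
  | nil => simpa [emit, size] using runsWithin_skip (memory inp out c)
  | cons a w ih => simpa [emit, size] using (runsWithin_push_output a).seq (ih (out ++ [a]))

theorem translates_emit (c : Counter → ℕ) (w : List CodeSym) :
    (emit w).Translates c c [] w :=
  fun inp out => (runsWithin_emit w inp out).mono (Nat.le_mul_of_pos_right _ (Nat.succ_pos _))

/-- Sets the counter `r` to `0`. -/
def clear (r : Counter) : Prog CodeSym :=
  loop r.stack Option.isSome (pop r.stack)

theorem runsWithin_clear (r : Counter) (inp out : List CodeSym) :
    (clear r).RunsWithin (memory inp out c) (memory inp out (Function.update c r 0))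
      (c r * 2 + 1) := by
  have h := runsWithin_loop (r := r.stack) (test := Option.isSome) (p := pop r.stack) (t := 1)
    (s := fun i => memory inp out (Function.update c r (c r - i))) (n := c r)
    (fun i hi => ⟨by simp [memory_stack, Nat.sub_ne_zero_of_lt hi], by
      simpa [Nat.sub_sub] using
        runsWithin_pop_counter (c := Function.update c r (c r - i)) r⟩) (by simp [memory_stack])
  simpa [clear] using h

theorem Translates.seq_clear {r : Counter} (hp : p.Translates c c' u w)
    (hr : c' r ≤ u.length + w.length) :
    (p.seq (clear r)).Translates c (Function.update c' r 0) u w := by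
  intro inp out
  refine ((hp inp out).seq (runsWithin_clear r inp (out ++ w))).mono ?_
  simp only [size, clear, add_mul]
  omega

/-- Moves the counter `r` to the counter `r'` and writes `w` for every unit moved. -/
def drain (r r' : Counter) (w : List CodeSym) : Prog CodeSym :=
  loop r.stack Option.isSome (seq (pop r.stack) (seq (push r'.stack .tick) (emit w)))

theorem runsWithin_drain {r r' : Counter} (hr : r' ≠ r) (w inp out : List CodeSym) :
    (drain r r' w).RunsWithin (memory inp out c)
      (memory inp (out ++ (List.replicate (c r) w).flatten)
        (Function.update (Function.update c r 0) r' (c r' + c r)))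
      ((drain r r' w).size * (c r + 1)) := by
  let state (i : ℕ) := memory inp (out ++ (List.replicate i w).flatten)
    (Function.update (Function.update c r (c r - i)) r' (c r' + i))
  have hstep (i : ℕ) :
      (seq (pop r.stack) (seq (push r'.stack .tick) (emit w))).RunsWithin
        (state i) (state (i + 1)) (1 + (1 + (emit w).size)) := by
    have h := (runsWithin_pop_counter (inp := inp) (out := out ++ (List.replicate i w).flatten)
      (c := Function.update (Function.update c r (c r - i)) r' (c r' + i)) r).seq
        ((runsWithin_push_counter r').seq (runsWithin_emit w inp _))
    simpa [state, Function.update_comm hr, hr, hr.symm, Nat.sub_sub, List.replicate_succ',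
      add_assoc] using h
  have h := runsWithin_loop (r := r.stack) (test := Option.isSome) (s := state) (n := c r)
    (fun i hi => ⟨by simp [state, memory_stack, hr.symm, Nat.sub_ne_zero_of_lt hi], hstep i⟩)
    (by simp [state, memory_stack, hr.symm])
  simp only [state, List.replicate_zero, List.flatten_nil, List.append_nil, Nat.sub_zero,
    Nat.add_zero, Function.update_eq_self, Nat.sub_self] at h
  refine h.mono ?_
  simp only [drain, size]
  linarith [Nat.zero_le (c r)]

/-- Writes the counter `r` as a number. -/
def writeNat (r : Counter) : Prog CodeSym :=
  seq (drain r .scratch [.tick]) (seq (push 1 .endNum) (drain .scratch r []))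

theorem translates_writeNat {r : Counter} (hr : r ≠ .scratch) (hc : c .scratch = 0) :
    (writeNat r).Translates c c [] (encNat (c r)) := by
  intro inp out
  have h := (runsWithin_drain (c := c) hr.symm [.tick] inp out).seq
    ((runsWithin_push_output .endNum).seq (runsWithin_drain hr [] inp _))
  have hrestore : Function.update (Function.update (Function.update (Function.update c r 0)
      .scratch (c r)) .scratch 0) r (c r) = c := by
    rw [Function.update_idem, Function.update_comm hr, Function.update_idem, ← hc,
      Function.update_eq_self, Function.update_eq_self]
  simp only [hc, zero_add, Function.update_self, Function.update_of_ne hr, hrestore] at h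
  simp only [List.flatten_replicate_nil, List.append_nil, List.flatten_replicate_singleton,
    List.append_assoc] at h
  refine h.mono ?_
  simp only [size, writeNat, encNat, List.length_append, List.length_replicate, List.length_cons,
    List.length_nil]
  nlinarith

/-- Adds the number read to the counter `number`. -/
def readNat : Prog CodeSym :=
  seq (loop 0 (· matches some .tick) (seq (pop 0) (push Counter.number.stack .tick))) (pop 0)

theorem translates_readNat (n : ℕ) :
    readNat.Translates c (Function.update c .number (c .number + n)) (encNat n) [] := by
  intro inp out
  let state (i : ℕ) := memory (encNat (n - i) ++ inp) out
    (Function.update c .number (c .number + i))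
  have hstep (i : ℕ) (hi : i < n) : (state i 0).head? = some .tick ∧
      (seq (pop 0) (push Counter.number.stack .tick)).RunsWithin (state i) (state (i + 1)) 2 := by
    have htick : encNat (n - i) = .tick :: encNat (n - (i + 1)) := by
      rw [encNat, encNat, show n - i = n - (i + 1) + 1 by omega, List.replicate_succ,
        List.cons_append]
    refine ⟨by simp [state, memory, htick], ?_⟩
    simpa [state, htick, add_assoc] using
      (runsWithin_pop_input .tick (inp := encNat (n - (i + 1)) ++ inp) (out := out)
        (c := Function.update c .number (c .number + i))).seq
          (runsWithin_push_counter Counter.number)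
  have hloop := runsWithin_loop (r := 0) (test := (· matches some .tick)) (s := state) (n := n)
    (fun i hi => ⟨by rw [(hstep i hi).1], (hstep i hi).2⟩) (by simp [state, memory, encNat])
  have h := hloop.seq (s'' := memory inp out (Function.update c .number (c .number + n)))
    (by simpa [state, encNat] using runsWithin_pop_input .endNum)
  simp only [state, Nat.sub_zero, Nat.add_zero, Function.update_eq_self] at h
  rw [List.append_nil]
  refine h.mono ?_
  simp only [size, readNat, encNat, List.length_append, List.length_replicate, List.length_cons,
    List.length_nil]
  omega

end Prog

/-! ## Writing the formula -/

theorem length_le_length_encList {α : Type} (e : α → List CodeSym) (l : List α) :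
    l.length ≤ (encList e l).length := by
  induction l with
  | nil => simp
  | cons a l ih =>
    simp only [encList, List.length_cons, List.length_append]
    omega

namespace C2Formula

theorem encode_foldr_and (l : List C2Formula) (φ : C2Formula) :
    (l.foldr .and φ).encode = (l.map fun ψ => .and :: ψ.encode).flatten ++ φ.encode := by
  induction l with
  | nil => rfl
  | cons ψ l ih => simp [encode, ih]

theorem encode_foldr_or (l : List C2Formula) (φ : C2Formula) :
    (l.foldr .or φ).encode = (l.map fun ψ => .or :: ψ.encode).flatten ++ φ.encode := by
  induction l with
  | nil => rfl
  | cons ψ l ih => simp [encode, ih]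

end C2Formula

namespace Prog

variable {α : Type} {e : α → List CodeSym} {p q : Prog CodeSym} {c : Counter → ℕ}

/-- Reads a list, using `p` to read each of its items. -/
def readItems (p : Prog CodeSym) : Prog CodeSym :=
  seq (loop 0 (· matches some .item) (seq (pop 0) p)) (pop 0)

theorem runsWithin_loop_items {c : ℕ → Counter → ℕ} {W : ℕ → α → List CodeSym}
    (hp : ∀ i a, p.Translates (c i) (c (i + 1)) (e a) (W i a)) (l : List α)
    (inp out : List CodeSym) :
    (loop 0 (· matches some .item) (seq (pop 0) p)).RunsWithin
      (memory (encList e l ++ inp) out (c 0))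
      (memory (.endList :: inp) (out ++ (l.mapIdx W).flatten) (c l.length))
      ((p.size + 2) * ((encList e l).length + (l.mapIdx W).flatten.length)) := by
  induction l generalizing c W out with
  | nil =>
    have hexit := runsWithin_loop_exit (p := seq (pop 0) p) (r := 0)
      (s := memory (.endList :: inp) out (c 0)) (test := (· matches some .item)) (by rfl)
    simpa [encList] using hexit.mono (Nat.le_add_left 1 (p.size + 1))
  | cons a l ih =>
    have hitem := (runsWithin_pop_input .item).seq (hp 0 a (encList e l ++ inp) out)
    have hrest := ih (c := fun i => c (i + 1)) (fun i a => hp (i + 1) a) (out ++ W 0 a)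
    have h := hitem.loop_step (r := 0) (test := (· matches some .item)) (by rfl) hrest
    simp only [encList, List.mapIdx_cons, List.flatten_cons, List.cons_append, List.append_assoc,
      List.length_cons, List.length_append] at h ⊢
    refine h.mono ?_
    nlinarith

theorem translates_readItems {c : ℕ → Counter → ℕ} {W : ℕ → α → List CodeSym}
    (hp : ∀ i a, p.Translates (c i) (c (i + 1)) (e a) (W i a)) (l : List α) :
    (readItems p).Translates (c 0) (c l.length) (encList e l) (l.mapIdx W).flatten := by
  intro inp out
  refine ((runsWithin_loop_items hp l inp out).seq (runsWithin_pop_input .endList)).mono ?_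
  simp only [readItems, size]
  nlinarith

/-- Reads a list and writes a conjunction: `p` turns an item into a conjunct, `q` writes the last
conjunct, and the counter `r` contains the number of items read before. -/
def readConj (r : Counter) (p q : Prog CodeSym) : Prog CodeSym :=
  seq (seq (readItems (seq (emit [.and]) (seq p (push r.stack .tick)))) q) (clear r)

theorem translates_readConj {r : Counter} {n : ℕ} {F : ℕ → α → C2Formula} {φ : C2Formula}
    (hr : c r = 0)
    (hp : ∀ i a, p.Translates (Function.update c r i) (Function.update c r i) (e a) (F i a).encode)
    (v : Fin n → α)
    (hq : q.Translates (Function.update c r n) (Function.update c r n) [] φ.encode) :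
    (readConj r p q).Translates c c (encFun e v)
      ((List.ofFn fun i => F i (v i)).foldr .and φ).encode := by
  have hitem (i : ℕ) (a : α) : (seq (emit [.and]) (seq p (push r.stack .tick))).Translates
      (Function.update c r i) (Function.update c r (i + 1)) (e a) (.and :: (F i a).encode) := by
    simpa using (translates_emit _ [.and]).seq ((hp i a).seq (translates_pushCounter _ r))
  have hitems := translates_readItems hitem (List.ofFn v)
  simp only [List.length_ofFn] at hitems
  have h := (hitems.seq hq).seq_clear (r := r) (by
    have := length_le_length_encList e (List.ofFn v)
    simp only [List.length_ofFn] at this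
    simp only [Function.update_self, List.append_nil]
    omega)
  simpa [readConj, ← hr, encFun, C2Formula.encode_foldr_and, List.mapIdx_eq_ofFn, Function.comp_def]
    using h

/-- Reads a list and writes a disjunction: `p` turns an item into a disjunct, and the last disjunct
is false. -/
def readDisj (p : Prog CodeSym) : Prog CodeSym :=
  seq (readItems (seq (emit [.or]) p)) (emit (C2Formula.not (.eq .x .x)).encode)

theorem translates_readDisj {F : α → C2Formula} (hp : ∀ a, p.Translates c c (e a) (F a).encode)
    (l : List α) :
    (readDisj p).Translates c c (encList e l)
      (C2Formula.encode ((l.map F).foldr .or (.not (.eq .x .x)))) := by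
  have hitem (_ : ℕ) (a : α) : (seq (emit [.or]) p).Translates c c (e a)
      (.or :: (F a).encode) := by
    simpa using (translates_emit _ [.or]).seq (hp a)
  have h := (translates_readItems (c := fun _ => c) hitem l).seq
    (translates_emit _ (C2Formula.not (.eq .x .x)).encode)
  have hmap : (l.mapIdx fun _ a => .or :: (F a).encode) = l.map fun a => .or :: (F a).encode :=
    List.ext_getElem (by simp) (by simp)
  simpa [readDisj, C2Formula.encode_foldr_or, Function.comp_def, hmap] using h

/-- Reads a number without writing anything. -/
def skipNat : Prog CodeSym :=
  seq readNat (clear .number)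

theorem translates_skipNat (hc : c .number = 0) (n : ℕ) :
    skipNat.Translates c c (encNat n) [] := by
  simpa [skipNat, ← hc] using (translates_readNat (c := c) n).seq_clear (r := .number)
    (by simp [hc, encNat])

open C2Formula

/-- Writes `∃^{=k}` for the value `k` of the counter `r`, using `q` to write the scope. -/
def writeExactly (r : Counter) (v : Var) (q : Prog CodeSym) : Prog CodeSym :=
  seq (emit [.and, .atLeast, v.encode]) (seq (writeNat r) (seq q
    (seq (emit [.atMost, v.encode]) (seq (writeNat r) q))))

theorem translates_writeExactly {r : Counter} {v : Var} {φ : C2Formula} (hr : r ≠ .scratch)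
    (hc : c .scratch = 0) (hq : q.Translates c c [] φ.encode) :
    (writeExactly r v q).Translates c c [] (exactly (c r) v φ).encode := by
  have hnat := translates_writeNat hr hc
  simpa [writeExactly, exactly, C2Formula.encode] using
    (translates_emit c [.and, .atLeast, v.encode]).seq
      (hnat.seq (hq.seq ((translates_emit c [.atMost, v.encode]).seq (hnat.seq hq))))

/-- Reads a number `k` and writes `∃^{=k}`, using `q` to write the scope. -/
def readExactly (v : Var) (q : Prog CodeSym) : Prog CodeSym :=
  seq (seq readNat (writeExactly .number v q)) (clear .number)

theorem translates_readExactly {v : Var} {φ : C2Formula} (hc : c .number = 0)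
    (hscratch : c .scratch = 0) (n : ℕ)
    (hq : q.Translates (Function.update c .number n) (Function.update c .number n) [] φ.encode) :
    (readExactly v q).Translates c c (encNat n) (exactly n v φ).encode := by
  have hread := translates_readNat (c := c) n
  rw [hc, zero_add] at hread
  have hwrite := translates_writeExactly (v := v) (r := .number) (by simp) (by simpa) hq
  rw [Function.update_self] at hwrite
  simpa [readExactly, ← hc] using (hread.seq hwrite).seq_clear (r := .number)
    (by simp only [Function.update_self, encNat, List.length_append, List.length_replicate]; omega)

/-- Writes `attached u v (c + 2)` for the value `c` of the counter `kind`. -/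
def writeAttached (u v : Var) : Prog CodeSym :=
  seq (emit [.and, .child, u.encode, v.encode, .and, .not, .unary, v.encode, .endNum,
    .unary, v.encode, .tick, .tick]) (writeNat .kind)

theorem translates_writeAttached (u v : Var) (hc : c .scratch = 0) :
    (writeAttached u v).Translates c c [] (attached u v (c .kind + 2)).encode :=
  (translates_emit c _).seq (translates_writeNat (r := .kind) (by simp) hc)

/-- Writes `consumed u v (c + 2)` for the value `c` of the counter `kind`. -/
def writeConsumed (u v : Var) : Prog CodeSym :=
  seq (emit [.and, .common, v.encode, u.encode, .endNum, .unary, v.encode, .tick, .tick])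
    (writeNat .kind)

theorem translates_writeConsumed (u v : Var) (hc : c .scratch = 0) :
    (writeConsumed u v).Translates c c [] (consumed u v (c .kind + 2)).encode :=
  (translates_emit c _).seq (translates_writeNat (r := .kind) (by simp) hc)

/-- Reads a vector `l` and writes `consumption u v l`. -/
def readConsumption (u v : Var) : Prog CodeSym :=
  readConj .kind (readExactly v (writeConsumed u v)) (emit (C2Formula.eq u u).encode)

theorem translates_readConsumption (u v : Var) {d : ℕ} (hnumber : c .number = 0)
    (hkind : c .kind = 0) (hscratch : c .scratch = 0) (l : Fin d → ℕ) :
    (readConsumption u v).Translates c c (encFun encNat l) (consumption u v l).encode := by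
  refine translates_readConj (F := fun i n => exactly n v (consumed u v (i + 2))) hkind
    (fun i n => ?_) l (translates_emit _ _)
  refine translates_readExactly (by simpa) (by simpa) n ?_
  simpa using translates_writeConsumed u v
    (c := Function.update (Function.update c .kind i) .number n) (by simpa)

/-- Writes `argument i φ` for the value `i` of the counter `index`, using `p` to write `φ`. -/
def readArgument (p : Prog CodeSym) : Prog CodeSym :=
  seq (emit [.ex, .varY, .and, .child, .varX, .varY, .and, .unary, .varY, .endNum, .and])
    (seq (writeExactly .index .x (emit (C2Formula.nav .foll .x .y).encode)) p)

theorem translates_readArgument {u : List CodeSym} {φ : C2Formula} (hc : c .scratch = 0)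
    (hp : p.Translates c c u φ.encode) :
    (readArgument p).Translates c c u (argument (c .index) φ).encode :=
  (translates_emit c _).seq ((translates_writeExactly (r := .index) (v := .x)
      (φ := .nav .foll .x .y) (by simp) hc (translates_emit c _)).seq hp)

/-- Reads a state `q` and writes `∃^{=q} v. attached u w 1`. -/
def readState (u w v : Var) : Prog CodeSym :=
  readExactly v (emit (attached u w 1).encode)

theorem translates_readState (u w v : Var) (hc : c .number = 0) (hscratch : c .scratch = 0)
    (n : ℕ) :
    (readState u w v).Translates c c (encNat n) (exactly n v (attached u w 1)).encode :=
  translates_readExactly hc hscratch n (translates_emit _ _)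

/-- Reads the source states of a rule and writes their conditions, and that the number of arguments
is correct. -/
def readSources : Prog CodeSym :=
  readConj .index (readArgument (readState .y .x .x))
    (writeExactly .index .y (emit (C2Formula.and (.nav .child .x .y) (run .y)).encode))

theorem translates_readSources {n k : ℕ} (q : Fin n → Fin k) :
    readSources.Translates (fun _ => 0) (fun _ => 0) (encFun encFin q)
      ((List.ofFn fun i => argument i (exactly (q i) .x (attached .y .x 1))).foldr .and
        (exactly n .y (.and (.nav .child .x .y) (run .y)))).encode := by
  refine translates_readConj (e := encFin)
    (F := fun i (a : Fin k) => argument i (exactly a .x (attached .y .x 1))) rfl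
    (fun i a => ?_) q ?_
  · simpa [encFin] using translates_readArgument (c := Function.update (fun _ => 0) .index i)
      (by simp) (translates_readState .y .x .x (by simp) (by simp) a)
  · simpa using translates_writeExactly (r := .index) (v := .y)
      (φ := .and (.nav .child .x .y) (run .y)) (c := Function.update (fun _ => 0) .index n)
      (by simp) (by simp) (translates_emit _ _)

/-- Reads the losses of a rule and writes the conditions on the tokens of its arguments. -/
def readLosses : Prog CodeSym :=
  readConj .index (readArgument (readConsumption .y .x)) (emit (C2Formula.eq .x .x).encode)

theorem translates_readLosses {n d : ℕ} (l : Fin n → Fin d → ℕ) :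
    readLosses.Translates (fun _ => 0) (fun _ => 0) (encFun (encFun encNat) l)
      (C2Formula.encode
        ((List.ofFn fun i => argument i (consumption .y .x (l i))).foldr .and (.eq .x .x))) := by
  refine translates_readConj (F := fun i l => argument i (consumption .y .x l)) rfl
    (fun i l => ?_) l (translates_emit _ _)
  simpa using translates_readArgument (c := Function.update (fun _ => 0) .index i) (by simp)
    (translates_readConsumption .y .x (by simp) (by simp) (by simp) l)

/-- Reads the gain of a rule and writes the conditions on the tokens it creates. -/
def readGain : Prog CodeSym :=
  readConj .kind (readExactly .y (writeAttached .x .y)) (emit (C2Formula.eq .x .x).encode)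

theorem translates_readGain {d : ℕ} (g : Fin d → ℕ) :
    readGain.Translates (fun _ => 0) (fun _ => 0) (encFun encNat g)
      (C2Formula.encode
        ((List.ofFn fun c => exactly (g c) .y (attached .x .y (c + 2))).foldr .and
          (.eq .x .x))) := by
  refine translates_readConj (F := fun i n => exactly n .y (attached .x .y (i + 2))) rfl
    (fun i n => translates_readExactly (by simp) (by simp) n ?_) g (translates_emit _ _)
  simpa using translates_writeAttached .x .y
    (c := Function.update (Function.update (fun _ => 0) .kind i) .number n) (by simp)

/-- Reads a rule and writes its formula. -/
def readRule : Prog CodeSym :=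
  seq skipNat (seq (emit [.and]) (seq readSources (seq (emit [.and]) (seq readLosses
    (seq (emit [.and]) (seq (readState .x .y .y) readGain))))))

theorem translates_readRule {m k d : ℕ} {rank : Fin m → ℕ} (r : VATARule rank k d) :
    readRule.Translates (fun _ => 0) (fun _ => 0) r.encode r.formula.encode := by
  simpa [readRule, VATARule.encode, VATARule.formula, encFin, C2Formula.encode] using
    (translates_skipNat rfl r.symbol).seq ((translates_emit _ [.and]).seq
      ((translates_readSources r.source).seq ((translates_emit _ [.and]).seq
        ((translates_readLosses r.loss).seq ((translates_emit _ [.and]).seq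
          ((translates_readState .x .y .y rfl rfl r.target).seq
            (translates_readGain r.gain)))))))

/-- Reads an accepting configuration and writes its formula. -/
def readConfiguration : Prog CodeSym :=
  seq (emit [.and]) (seq (readState .x .y .y) (readConsumption .x .y))

theorem translates_readConfiguration {k d : ℕ} (a : Fin k × (Fin d → ℕ)) :
    readConfiguration.Translates (fun _ => 0) (fun _ => 0) (encFin a.1 ++ encFun encNat a.2)
      (configuration a.1 a.2).encode := by
  simpa [readConfiguration, configuration, C2Formula.encode, encFin] using
    (translates_emit _ [.and]).seq ((translates_readState .x .y .y rfl rfl a.1).seq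
      (translates_readConsumption .x .y rfl rfl rfl a.2))

/-- The code of `VATA.formula` up to the formulas of the rules. -/
def ruleContext : List CodeSym :=
  .and :: ((C2Formula.all .x (.all .y (.or (.not (.nav .child .x .y)) (run .x)))).encode ++
    .and :: ((C2Formula.all .x (.all .y (.or (.not (.common 0 .x .y))
        (.and (.not (run .x)) (.nav .desc .y .x))))).encode ++
      .and :: ((C2Formula.all .x (.or (run .x) (exactly 1 .y (.common 0 .x .y)))).encode ++
        [.and, .all, .varX, .or] ++ (C2Formula.not (run .x)).encode)))

/-- The code of `VATA.formula` between the formulas of the rules and those of the accepting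
configurations. -/
def acceptingContext : List CodeSym :=
  [.ex, .varX, .and] ++ (run .x).encode ++
    .and :: (C2Formula.not (.ex .y (.nav .child .y .x))).encode

/-- Reads an automaton and writes its formula. -/
def writeFormula : Prog CodeSym :=
  seq (readItems skipNat) (seq skipNat (seq skipNat (seq (emit ruleContext) (seq (readDisj readRule)
    (seq (emit acceptingContext) (readDisj readConfiguration))))))

theorem translates_writeFormula (A : VATA) :
    writeFormula.Translates (fun _ => 0) (fun _ => 0) A.encode A.formula.encode := by
  have hrank := translates_readItems (c := fun _ _ => 0) (W := fun _ _ => [])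
    (fun _ n => translates_skipNat rfl n) (List.ofFn A.rank)
  have hempty : ((List.ofFn A.rank).mapIdx fun _ _ => ([] : List CodeSym)).flatten = [] := by simp
  rw [hempty] at hrank
  simpa [writeFormula, VATA.encode, VATA.formula, C2Formula.encode, encFun, ruleContext,
    acceptingContext, Var.encode] using
    hrank.seq ((translates_skipNat rfl A.numStates).seq ((translates_skipNat rfl A.dim).seq
      ((translates_emit _ ruleContext).seq ((translates_readDisj translates_readRule A.rules).seq
        ((translates_emit _ acceptingContext).seq
          (translates_readDisj translates_readConfiguration A.accepting))))))

end Prog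

/-! ## The length of the formula -/

theorem length_encNat (n : ℕ) : (encNat n).length = n + 1 := by
  simp [encNat]

theorem length_lt_length_encFun {α : Type} {n : ℕ} (e : α → List CodeSym) (v : Fin n → α)
    (i : Fin n) : (e (v i)).length < (encFun e v).length := by
  have length_lt {a : α} {l : List α} (ha : a ∈ l) : (e a).length < (encList e l).length := by
    induction ha <;> simp only [encList, List.length_cons, List.length_append] <;> omega
  exact length_lt (List.mem_ofFn.2 ⟨i, rfl⟩)

theorem length_encFun_pos {α : Type} {n : ℕ} (e : α → List CodeSym) (v : Fin n → α) :
    0 < (encFun e v).length := by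
  rw [encFun]
  cases List.ofFn v <;> simp [encList]

namespace C2Formula

variable {α : Type} {e : α → List CodeSym} {M N : ℕ} {φ : C2Formula}

theorem length_encode_foldr_and_le {n : ℕ} {v : Fin n → α} {F : Fin n → C2Formula} (hM : 1 ≤ M)
    (hF : ∀ i, (F i).encode.length ≤ M * (e (v i)).length) :
    ((List.ofFn F).foldr .and φ).encode.length ≤
      M * (encFun e v).length + φ.encode.length := by
  induction n with
  | zero => simp
  | succ n ih =>
    have htail := ih (v := fun i => v i.succ) (F := fun i => F i.succ) fun i => hF i.succ
    have hhead := hF 0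
    simp only [encFun, List.ofFn_succ, List.foldr_cons, encode, encList, List.length_cons,
      List.length_append, mul_add, mul_one] at htail ⊢
    omega

theorem length_encode_foldr_or_le {F : α → C2Formula} (hM : 1 ≤ M)
    (hF : ∀ a, (F a).encode.length ≤ M * (e a).length) (l : List α) :
    ((l.map F).foldr .or φ).encode.length ≤ M * (encList e l).length + φ.encode.length := by
  induction l with
  | nil => simp
  | cons a l ih =>
    have hhead := hF a
    simp only [List.map_cons, List.foldr_cons, encode, encList, List.length_cons,
      List.length_append, mul_add, mul_one] at ih ⊢
    omega

theorem length_encode_exactly (k : ℕ) (v : Var) (φ : C2Formula) :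
    (exactly k v φ).encode.length = 2 * φ.encode.length + 2 * k + 7 := by
  simp only [exactly, encode, length_encNat, List.length_cons, List.length_append]
  omega

theorem length_encode_attached (u v : Var) (s : ℕ) : (attached u v s).encode.length = s + 12 := by
  simp only [attached, run, encode, length_encNat, List.length_cons, List.length_append,
    List.length_nil]
  omega

theorem length_encode_consumption_le {d : ℕ} (hd : d ≤ N) (u v : Var) (l : Fin d → ℕ) :
    (consumption u v l).encode.length ≤ (2 * N + 29) * (encFun encNat l).length + 3 := by
  refine length_encode_foldr_and_le (by omega) fun c => ?_
  have hc := c.2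
  simp only [length_encode_exactly, consumed, encode, length_encNat, List.length_cons,
    List.length_append]
  nlinarith

theorem length_encode_argument (i : ℕ) (φ : C2Formula) :
    (argument i φ).encode.length = φ.encode.length + 2 * i + 24 := by
  simp only [argument, run, encode, length_encode_exactly, length_encNat, List.length_cons,
    List.length_append, List.length_nil]
  omega

theorem length_encode_configuration_le {k d : ℕ} (hd : d ≤ N) (q : Fin k) (l : Fin d → ℕ) :
    (configuration q l).encode.length ≤
      (4 * N + 90) * (encFin q ++ encFun encNat l).length := by
  have h := length_encode_consumption_le hd .x .y l
  simp only [configuration, encode, length_encode_exactly, length_encode_attached, encFin,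
    length_encNat, List.length_cons, List.length_append]
  nlinarith

end C2Formula

open C2Formula in
theorem VATARule.length_encode_formula_le {m k d N : ℕ} {rank : Fin m → ℕ}
    (r : VATARule rank k d) (hd : d ≤ N) (hrank : rank r.symbol ≤ N) :
    r.formula.encode.length ≤ (4 * N + 90) * r.encode.length := by
  have hsources := length_encode_foldr_and_le (M := 4 * N + 60) (e := encFin) (v := r.source)
    (F := fun i => argument i (exactly (r.source i) .x (attached .y .x 1)))
    (φ := exactly (rank r.symbol) .y (.and (.nav .child .x .y) (run .y))) (by omega) fun i => by
      have hi := i.2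
      simp only [length_encode_argument, length_encode_exactly, length_encode_attached, encFin,
        length_encNat]
      nlinarith
  have hlosses := length_encode_foldr_and_le (M := 4 * N + 60) (e := encFun encNat) (v := r.loss)
    (F := fun i => argument i (consumption .y .x (r.loss i))) (φ := .eq .x .x) (by omega)
    fun i => by
      have hi := i.2
      have hpos := length_encFun_pos encNat (r.loss i)
      have h := length_encode_consumption_le hd .y .x (r.loss i)
      rw [length_encode_argument]
      nlinarith
  have hgain := length_encode_foldr_and_le (M := 4 * N + 60) (e := encNat) (v := r.gain)
    (F := fun c => exactly (r.gain c) .y (attached .x .y (c + 2))) (φ := .eq .x .x) (by omega)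
    fun c => by
      have hc := c.2
      simp only [length_encode_exactly, length_encode_attached, length_encNat]
      nlinarith
  have hcount : (exactly (rank r.symbol) .y (.and (.nav .child .x .y) (run .y))).encode.length =
      2 * rank r.symbol + 21 := by
    simp only [length_encode_exactly, run, C2Formula.encode, length_encNat, List.length_cons,
      List.length_append, List.length_nil]
    omega
  have htrue : (C2Formula.eq .x .x).encode.length = 3 := rfl
  rw [hcount] at hsources
  rw [htrue] at hlosses hgain
  have hsource : rank r.symbol ≤ (encFun encFin r.source).length := by
    simpa [encFun] using length_le_length_encList encFin (List.ofFn r.source)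
  simp only [formula, C2Formula.encode, VATARule.encode, length_encode_exactly,
    length_encode_attached, encFin, length_encNat, List.length_cons, List.length_append, mul_add]
    at hsource hsources hlosses hgain ⊢
  nlinarith

theorem VATA.length_encode_formula_le (A : VATA) :
    A.formula.encode.length ≤ (4 * A.encode.length + 200) * A.encode.length := by
  have hlen : A.encode.length = (encFun encNat A.rank).length + (A.numStates + 1 + (A.dim + 1 +
      ((encList VATARule.encode A.rules).length +
        (encList (fun c => encFin c.1 ++ encFun encNat c.2) A.accepting).length))) := by
    simp [encode, length_encNat]
  set N := A.encode.length
  have hrank (f : Fin A.numSymbols) : A.rank f ≤ N := by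
    have := length_lt_length_encFun encNat A.rank f
    rw [length_encNat] at this
    omega
  have hrules := C2Formula.length_encode_foldr_or_le (M := 4 * N + 90)
    (φ := .not (.eq .x .x)) (by omega)
    (fun r => VATARule.length_encode_formula_le r (by omega) (hrank r.symbol)) A.rules
  have haccepting := C2Formula.length_encode_foldr_or_le (M := 4 * N + 90)
    (φ := .not (.eq .x .x)) (by omega)
    (fun a : Fin A.numStates × (Fin A.dim → ℕ) =>
      C2Formula.length_encode_configuration_le (N := N) (by omega) a.1 a.2)
    A.accepting
  have hfalse : (C2Formula.not (.eq .x .x)).encode.length = 4 := rfl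
  rw [hfalse] at hrules haccepting
  simp only [formula, C2Formula.run, C2Formula.length_encode_exactly, C2Formula.encode,
    length_encNat, List.length_cons, List.length_append, List.length_nil] at hrules haccepting ⊢
  nlinarith

/-! ## The reduction takes polynomial time -/

namespace Prog

variable {Γ : Type} {r r' : ℕ} {l : List Γ}

open Classical in
/-- Moves the top symbol of the stack `r` to the stack `r'` if it belongs to `l`. -/
noncomputable def moveTop (r r' : ℕ) : List Γ → Prog Γ
  | [] => skip
  | a :: l => ite r (fun o => decide (o = some a)) (seq (pop r) (push r' a)) (moveTop r r' l)

theorem runsWithin_moveTop (hr : r' ≠ r) {a : Γ} (ha : a ∈ l) {s : ℕ → List Γ} {w : List Γ}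
    (hs : s r = a :: w) :
    (moveTop r r' l).RunsWithin s (Function.update (Function.update s r w) r' (a :: s r'))
      (l.length + 2) := by
  induction l with
  | nil => simp at ha
  | cons b l ih =>
    by_cases hab : a = b
    · subst hab
      have h := (runsWithin_pop r s).seq (runsWithin_push r' a _)
      rw [hs, List.tail_cons, Function.update_of_ne hr] at h
      exact (RunsWithin.ite_true (by simp [hs]) h).mono (by simp)
    · have h := ih ((List.mem_cons.1 ha).resolve_left hab)
      exact (RunsWithin.ite_false (by simp [hs, hab]) h).mono (by simp)

/-- Moves the stack `r`, whose symbols belong to `l`, to the stack `r'`, symbol by symbol. -/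
noncomputable def moveStack (r r' : ℕ) (l : List Γ) : Prog Γ :=
  loop r Option.isSome (moveTop r r' l)

theorem runsWithin_moveStack (hr : r' ≠ r) (hl : ∀ a, a ∈ l) {s : ℕ → List Γ} {w : List Γ}
    (hs : s r = w) :
    (moveStack r r' l).RunsWithin s
      (Function.update (Function.update s r []) r' (w.reverse ++ s r'))
      ((l.length + 3) * w.length + 1) := by
  induction w generalizing s with
  | nil =>
    have h := runsWithin_loop_exit (p := moveTop r r' l) (s := s) (r := r) (test := Option.isSome)
      (by simp [hs])
    have hstate : Function.update (Function.update s r []) r' (s r') = s := by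
      rw [← hs, Function.update_eq_self, Function.update_eq_self]
    simpa [moveStack, hstate] using h
  | cons a w ih =>
    have hrest := ih (s := Function.update (Function.update s r w) r' (a :: s r'))
      (by simp [hr.symm])
    have h := (runsWithin_moveTop hr (hl a) hs).loop_step (test := Option.isSome) (by simp [hs])
      hrest
    rw [Function.update_comm hr] at h
    simp only [Function.update_idem, Function.update_self] at h
    have htime : l.length + 2 + ((l.length + 3) * w.length + 1) + 1 ≤
        (l.length + 3) * (a :: w).length + 1 := by
      rw [List.length_cons]
      linarith
    simpa [moveStack] using h.mono htime

theorem start_eq_memory (w : List CodeSym) : start w = memory w [] fun _ => 0 := by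
  funext i
  rcases i with _ | _ | _ | _ | _ | _ | i <;> rfl

end Prog

open Prog in
theorem VATA.polyTimeComputable_sentence :
    PolyTimeComputable VATA.encode C2Sentence.encode VATA.sentence := by
  have := Fintype.ofFinite CodeSym
  let symbols : List CodeSym := Finset.univ.toList
  let bound : Polynomial ℕ := (4 * Polynomial.X + 200) * Polynomial.X
  refine ⟨writeFormula.seq (moveStack 1 0 symbols),
    (writeFormula.size : Polynomial ℕ) * (Polynomial.X + bound + 1) +
      (((symbols.length : Polynomial ℕ) + 3) * bound + 1),
    fun A => ?_⟩
  have hwrite := translates_writeFormula A [] []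
  rw [List.append_nil, List.nil_append, ← start_eq_memory] at hwrite
  obtain ⟨t, ht, h⟩ := hwrite.seq (runsWithin_moveStack (r := 1) (r' := 0) (l := symbols)
    (by simp) (by simp [symbols]) rfl)
  refine ⟨_, t, h, by simp [memory, C2Sentence.encode, sentence], ht.trans ?_⟩
  have hlen := A.length_encode_formula_le
  simp only [bound, memory, List.length_reverse, Polynomial.eval_add, Polynomial.eval_mul,
    Polynomial.eval_natCast, Nat.cast_id, Polynomial.eval_X, Polynomial.eval_one,
    Polynomial.eval_ofNat]
  gcongr

/-! ## The meaning of the formula -/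

namespace TreeStructure

variable {T : TreeStructure} {e : Var → T.dom} {φ : C2Formula}

theorem sat_exactly {k : ℕ} {v : Var} :
    T.Sat (.exactly k v φ) e ↔ {a | T.Sat φ (Function.update e v a)}.ncard = k :=
  ⟨fun h => le_antisymm h.2 h.1, fun h => ⟨h.ge, h.le⟩⟩

theorem sat_foldr_and {l : List C2Formula} :
    T.Sat (l.foldr .and φ) e ↔ (∀ ψ ∈ l, T.Sat ψ e) ∧ T.Sat φ e := by
  induction l with
  | nil => simp
  | cons ψ l ih => simp [Sat, ih, and_assoc]

theorem sat_foldr_or {l : List C2Formula} :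
    T.Sat (l.foldr .or φ) e ↔ (∃ ψ ∈ l, T.Sat ψ e) ∨ T.Sat φ e := by
  induction l with
  | nil => simp
  | cons ψ l ih => simp [Sat, ih, or_assoc]

theorem mem_dom_of_le {p : List ℕ} {i j : ℕ} (hij : i ≤ j) (hj : p ++ [j] ∈ T.dom) :
    p ++ [i] ∈ T.dom := by
  induction hij using Nat.decreasingInduction with
  | self => exact hj
  | of_succ i _ ih => exact T.left_mem p i ih

theorem transGen_next_iff {t u : T.dom} :
    Relation.TransGen T.Next t u ↔ ∃ p i j, i < j ∧ t.1 = p ++ [i] ∧ u.1 = p ++ [j] := by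
  constructor
  · intro h
    induction h with
    | single h =>
      obtain ⟨p, i, ht, hu⟩ := h
      exact ⟨p, i, i + 1, i.lt_succ_self, ht, hu⟩
    | tail _ h ih =>
      obtain ⟨p, i, j, hij, ht, hu⟩ := ih
      obtain ⟨p', j', hu', hw⟩ := h
      obtain ⟨rfl, hj⟩ := List.append_inj' (hu.symm.trans hu') rfl
      obtain rfl : j = j' := by simpa using hj
      exact ⟨p, i, j + 1, by omega, ht, hw⟩
  · rintro ⟨p, i, j, hij, ht, hu⟩
    induction j, hij using Nat.le_induction generalizing u with
    | base => exact .single ⟨p, i, ht, hu⟩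
    | succ j _ ih =>
      exact .tail (ih (u := ⟨p ++ [j], T.left_mem p j (hu ▸ u.2)⟩) rfl) ⟨p, j, rfl, hu⟩

theorem ncard_transGen_next {u : T.dom} {p : List ℕ} {i : ℕ} (hu : u.1 = p ++ [i]) :
    {t | Relation.TransGen T.Next t u}.ncard = i := by
  refine Set.ncard_eq_of_bijective (fun j hj => ⟨p ++ [j], mem_dom_of_le hj.le (hu ▸ u.2)⟩)
    (fun t ht => ?_) (fun j hj => transGen_next_iff.2 ⟨p, j, i, hj, rfl, hu⟩)
    (fun j k _ _ h => by simpa using h)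
  obtain ⟨p', j, i', hj, ht, hu'⟩ := transGen_next_iff.1 ht
  obtain ⟨rfl, hi⟩ := List.append_inj' (hu.symm.trans hu') rfl
  obtain rfl : i = i' := by simpa using hi
  exact ⟨j, hj, Subtype.ext ht.symm⟩

theorem transGen_child_iff {u w : T.dom} :
    Relation.TransGen T.Child u w ↔ u.1 <+: w.1 ∧ u ≠ w := by
  constructor
  · intro h
    suffices u.1 <+: w.1 ∧ u.1.length < w.1.length from
      ⟨this.1, fun huw => this.2.ne (huw ▸ rfl)⟩
    induction h with
    | single h =>
      obtain ⟨i, hi⟩ := h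
      simp [hi]
    | tail _ h ih =>
      obtain ⟨i, hi⟩ := h
      rw [hi, List.length_append]
      exact ⟨ih.1.trans (List.prefix_append _ _), ih.2.trans (by simp)⟩
  · rintro ⟨⟨q, hq⟩, hne⟩
    induction q using List.reverseRecOn generalizing w with
    | nil => exact (hne (Subtype.ext (by simpa using hq))).elim
    | append_singleton q i ih =>
      rw [← List.append_assoc] at hq
      let parent : T.dom := ⟨u.1 ++ q, T.parent_mem _ i (hq ▸ w.2)⟩
      have hchild : T.Child parent w := ⟨i, hq.symm⟩
      by_cases hu : u = parent
      · exact .single (hu ▸ hchild)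
      · exact .tail (ih (w := parent) hu rfl) hchild

/-- The node `u` is a run node. -/
def Run (u : T.dom) : Prop :=
  T.unary 0 u

/-- The number of leaves of kind `s` attached to `u`. -/
noncomputable def numAttached (s : ℕ) (u : T.dom) : ℕ :=
  {t | T.Child u t ∧ ¬ Run t ∧ T.unary s t}.ncard

/-- The number of leaves of kind `s` consumed at `u`. -/
noncomputable def numConsumed (s : ℕ) (u : T.dom) : ℕ :=
  {t | T.common 0 t u ∧ T.unary s t}.ncard

/-- The run node `w` represents an application of the rule `r`. -/
structure IsStep {m k d : ℕ} {rank : Fin m → ℕ} (r : VATARule rank k d) (w : T.dom) : Prop where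
  arity : {u | T.Child w u ∧ Run u}.ncard = rank r.symbol
  argument (i : Fin (rank r.symbol)) : ∃ u : T.dom, u.1 = w.1 ++ [i.1] ∧ Run u ∧
    numAttached 1 u = r.source i ∧ ∀ c : Fin d, numConsumed (c + 2) u = r.loss i c
  target : numAttached 1 w = r.target
  gain (c : Fin d) : numAttached (c + 2) w = r.gain c

/-- The tree represents an accepting run of `A`. -/
structure IsRun (A : VATA) (T : TreeStructure) : Prop where
  run_of_child {u w : T.dom} : T.Child u w → Run u
  desc_of_consumed {u w : T.dom} : T.common 0 u w → ¬ Run u ∧ Relation.TransGen T.Child w u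
  consumed_once {u : T.dom} : ¬ Run u → {w | T.common 0 u w}.ncard = 1
  step {u : T.dom} : Run u → ∃ r ∈ A.rules, IsStep r u
  accept : ∃ u : T.dom, Run u ∧ (¬ ∃ w, T.Child w u) ∧ ∃ a ∈ A.accepting,
    numAttached 1 u = a.1 ∧ ∀ c : Fin A.dim, numConsumed (c + 2) u = a.2 c

theorem sat_exactly_attached {u v : Var} (huv : u ≠ v) {k s : ℕ} :
    T.Sat (.exactly k v (.attached u v s)) e ↔ numAttached s (e u) = k := by
  simp [sat_exactly, C2Formula.attached, C2Formula.run, Sat, navRel, huv, numAttached, Run]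

theorem sat_consumption {u v : Var} (huv : u ≠ v) {d : ℕ} {l : Fin d → ℕ} :
    T.Sat (.consumption u v l) e ↔ ∀ c : Fin d, numConsumed (c + 2) (e u) = l c := by
  simp [C2Formula.consumption, sat_foldr_and, sat_exactly, C2Formula.consumed, Sat, huv,
    numConsumed, List.mem_ofFn]

theorem sat_configuration {k d : ℕ} {q : Fin k} {l : Fin d → ℕ} :
    T.Sat (.configuration q l) e ↔
      numAttached 1 (e .x) = q ∧ ∀ c : Fin d, numConsumed (c + 2) (e .x) = l c := by
  rw [C2Formula.configuration, Sat, sat_exactly_attached (by simp), sat_consumption (by simp)]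

theorem sat_argument {i : ℕ} : T.Sat (.argument i φ) e ↔
    ∃ u : T.dom, u.1 = (e .x).1 ++ [i] ∧ Run u ∧ T.Sat φ (Function.update e .y u) := by
  simp only [C2Formula.argument, Sat, navRel, C2Formula.run, sat_exactly, Function.update_self, Run,
    Function.update_of_ne (show Var.x ≠ Var.y by simp),
    Function.update_of_ne (show Var.y ≠ Var.x by simp)]
  refine exists_congr fun u => ⟨?_, ?_⟩
  · rintro ⟨⟨j, hj⟩, hu, hindex, hφ⟩
    rw [ncard_transGen_next hj] at hindex
    exact ⟨hindex ▸ hj, hu, hφ⟩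
  · rintro ⟨hi, hu, hφ⟩
    exact ⟨⟨i, hi⟩, hu, ncard_transGen_next hi, hφ⟩

theorem sat_ruleFormula {m k d : ℕ} {rank : Fin m → ℕ} {r : VATARule rank k d} :
    T.Sat r.formula e ↔ IsStep r (e .x) := by
  have harity : T.Sat (.exactly (rank r.symbol) .y (.and (.nav .child .x .y) (.run .y))) e ↔
      {u | T.Child (e .x) u ∧ Run u}.ncard = rank r.symbol := by
    simp [sat_exactly, C2Formula.run, Sat, navRel, Run]
  simp only [VATARule.formula, Sat, sat_foldr_and, List.forall_mem_ofFn_iff, sat_argument, harity,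
    sat_exactly_attached (show Var.y ≠ Var.x by simp),
    sat_exactly_attached (show Var.x ≠ Var.y by simp),
    sat_consumption (show Var.y ≠ Var.x by simp), Function.update_self, and_true]
  constructor
  · rintro ⟨⟨hsource, harity⟩, hloss, htarget, hgain⟩
    refine ⟨harity, fun i => ?_, htarget, hgain⟩
    obtain ⟨u, hu, hrun, hq⟩ := hsource i
    obtain ⟨u', hu', -, hl⟩ := hloss i
    obtain rfl : u = u' := Subtype.ext (hu.trans hu'.symm)
    exact ⟨u, hu, hrun, hq, hl⟩
  · rintro ⟨harity, hargument, htarget, hgain⟩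
    choose u hu hrun hq hl using hargument
    exact ⟨⟨fun i => ⟨u i, hu i, hrun i, hq i⟩, harity⟩, fun i => ⟨u i, hu i, hrun i, hl i⟩,
      htarget, hgain⟩

theorem sat_formula {A : VATA} : T.Sat A.formula e ↔ IsRun A T := by
  have hrule {u : T.dom} : (∃ φ ∈ A.rules.map VATARule.formula,
      T.Sat φ (Function.update e .x u)) ↔ ∃ r ∈ A.rules, IsStep r u := by
    simp [sat_ruleFormula]
  have haccept {u : T.dom} : (∃ φ ∈ A.accepting.map fun a => .configuration a.1 a.2,
      T.Sat φ (Function.update e .x u)) ↔ ∃ a ∈ A.accepting,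
        numAttached 1 u = a.1 ∧ ∀ c : Fin A.dim, numConsumed (c + 2) u = a.2 c := by
    simp only [List.mem_map, exists_exists_and_eq_and, sat_configuration, Function.update_self]
  simp only [VATA.formula, Sat, sat_foldr_or, hrule, haccept, sat_exactly, navRel, C2Formula.run,
    Function.update_self, Function.update_of_ne (show Var.x ≠ Var.y by simp), not_true_eq_false,
    or_false]
  exact ⟨fun ⟨hchild, hconsumed, honce, hstep, haccept⟩ =>
      ⟨(hchild _ _).resolve_left ∘ not_not.2, (hconsumed _ _).resolve_left ∘ not_not.2,
        (honce _).resolve_left, (hstep _).resolve_left ∘ not_not.2, haccept⟩,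
    fun h => ⟨fun _ _ => imp_iff_not_or.1 h.run_of_child,
      fun _ _ => imp_iff_not_or.1 h.desc_of_consumed,
      fun _ => or_iff_not_imp_left.2 h.consumed_once, fun _ => imp_iff_not_or.1 h.step, h.accept⟩⟩

end TreeStructure

/-! ## Soundness -/

namespace TreeStructure

variable {T : TreeStructure} {A : VATA} {s n : ℕ} {u v w t : T.dom}

theorem Child.parent_unique (hv : T.Child v u) (hw : T.Child w u) : v = w := by
  obtain ⟨i, hi⟩ := hv
  obtain ⟨j, hj⟩ := hw
  exact Subtype.ext (List.append_inj_left' (hi.symm.trans hj) rfl)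

theorem Child.transGen_iff (h : T.Child w u) :
    Relation.TransGen T.Child v u ↔ Relation.ReflTransGen T.Child v w := by
  refine ⟨fun hv => ?_, fun hv => .tail' hv h⟩
  obtain ⟨w', hw', hu⟩ := Relation.TransGen.tail'_iff.1 hv
  exact h.parent_unique hu ▸ hw'

theorem not_transGen_child_self : ¬ Relation.TransGen T.Child u u :=
  fun h => (transGen_child_iff.1 h).2 rfl

theorem wellFounded_swap_child : WellFounded (Function.swap T.Child) := by
  have : IsTrans T.dom (Function.swap (Relation.TransGen T.Child)) := ⟨fun _ _ _ h h' => h'.trans h⟩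
  have : Std.Irrefl (Function.swap (Relation.TransGen T.Child)) :=
    ⟨fun _ => not_transGen_child_self⟩
  exact Subrelation.wf (Relation.TransGen.single (r := T.Child))
    (Finite.wellFounded_of_trans_of_irrefl (Function.swap (Relation.TransGen T.Child)))

theorem Child.eq_of_reflTransGen (hu : T.Child w u) (hv : T.Child w v)
    (hut : Relation.ReflTransGen T.Child u t) (hvt : Relation.ReflTransGen T.Child v t) :
    u = v := by
  have prefix_of {a : T.dom} (h : Relation.ReflTransGen T.Child a t) : a.1 <+: t.1 := by
    obtain rfl | h := Relation.reflTransGen_iff_eq_or_transGen.1 h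
    · exact List.prefix_rfl
    · exact (transGen_child_iff.1 h).1
  obtain ⟨i, hi⟩ := hu
  obtain ⟨j, hj⟩ := hv
  have hlength : u.1.length = v.1.length := by simp [hi, hj]
  exact Subtype.ext ((List.prefix_of_prefix_length_le (prefix_of hut) (prefix_of hvt)
    hlength.le).eq_of_length hlength)

/-- The leaves of kind `s` below `u` which are consumed at `u` or above. For a run node `u` and a
counter kind `s`, their number is the value of the counter in the configuration reached at `u`. -/
def carried (s : ℕ) (u : T.dom) : Set T.dom :=
  {t | T.unary s t ∧ ¬ Run t ∧ Relation.TransGen T.Child u t ∧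
    ∃ v, T.common 0 t v ∧ Relation.ReflTransGen T.Child v u}

/-- The leaves of kind `s` below `u` which are consumed above `u`: what `u` passes on to its
parent. -/
def passedOn (s : ℕ) (u : T.dom) : Set T.dom :=
  {t | T.unary s t ∧ ¬ Run t ∧ Relation.TransGen T.Child u t ∧
    ∃ v, T.common 0 t v ∧ Relation.TransGen T.Child v u}

namespace IsRun

theorem existsUnique_consumer (hT : IsRun A T) (ht : ¬ Run t) : ∃! v, T.common 0 t v := by
  obtain ⟨v, hv⟩ := Set.ncard_eq_one.1 (hT.consumed_once ht)
  exact ⟨v, hv.superset rfl, fun w hw => hv.subset hw⟩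

theorem carried_eq_union (hT : IsRun A T) :
    carried s u = passedOn s u ∪ {t | T.common 0 t u ∧ T.unary s t} := by
  ext t
  constructor
  · rintro ⟨hs, ht, hut, v, hv, hvu⟩
    obtain rfl | hvu := Relation.reflTransGen_iff_eq_or_transGen.1 hvu
    · exact .inr ⟨hv, hs⟩
    · exact .inl ⟨hs, ht, hut, v, hv, hvu⟩
  · rintro (⟨hs, ht, hut, v, hv, hvu⟩ | ⟨hu, hs⟩)
    · exact ⟨hs, ht, hut, v, hv, hvu.to_reflTransGen⟩
    · obtain ⟨ht, hut⟩ := hT.desc_of_consumed hu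
      exact ⟨hs, ht, hut, u, hu, .refl⟩

theorem ncard_carried (hT : IsRun A T) :
    (carried s u).ncard = (passedOn s u).ncard + numConsumed s u := by
  rw [hT.carried_eq_union, Set.ncard_union_eq ?_, numConsumed]
  rw [Set.disjoint_left]
  rintro t ⟨-, ht, -, v, hv, hvu⟩ ⟨hu, -⟩
  obtain rfl := (hT.existsUnique_consumer ht).unique hv hu
  exact not_transGen_child_self hvu

theorem carried_eq_iUnion (hT : IsRun A T) {u : Fin n → T.dom}
    (hu : Set.range u = {u | T.Child w u ∧ Run u}) :
    carried s w = (⋃ i, passedOn s (u i)) ∪ {t | T.Child w t ∧ ¬ Run t ∧ T.unary s t} := by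
  have hchild (i : Fin n) : T.Child w (u i) := (hu.subset ⟨i, rfl⟩).1
  ext t
  simp only [Set.mem_union, Set.mem_iUnion]
  constructor
  · rintro ⟨hs, ht, hwt, v, hv, hvw⟩
    obtain ⟨u', hwu', hu't⟩ := Relation.TransGen.head'_iff.1 hwt
    obtain rfl | hu't := Relation.reflTransGen_iff_eq_or_transGen.1 hu't
    · exact .inr ⟨hwu', ht, hs⟩
    · obtain ⟨_, hu'', -⟩ := Relation.TransGen.head'_iff.1 hu't
      obtain ⟨i, rfl⟩ := hu.superset ⟨hwu', hT.run_of_child hu''⟩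
      exact .inl ⟨i, hs, ht, hu't, v, hv, hwu'.transGen_iff.2 hvw⟩
  · rintro (⟨i, hs, ht, hut, v, hv, hvu⟩ | ⟨hwt, ht, hs⟩)
    · exact ⟨hs, ht, .head (hchild i) hut, v, hv, (hchild i).transGen_iff.1 hvu⟩
    · obtain ⟨v, hv, -⟩ := hT.existsUnique_consumer ht
      exact ⟨hs, ht, .single hwt, v, hv, hwt.transGen_iff.1 (hT.desc_of_consumed hv).2⟩

theorem ncard_carried_eq_sum (hT : IsRun A T) {u : Fin n → T.dom} (hinj : Function.Injective u)
    (hu : Set.range u = {u | T.Child w u ∧ Run u}) :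
    (carried s w).ncard = ∑ i, (passedOn s (u i)).ncard + numAttached s w := by
  have hchild (i : Fin n) : T.Child w (u i) := (hu.subset ⟨i, rfl⟩).1
  rw [hT.carried_eq_iUnion hu, Set.ncard_union_eq ?_, Set.ncard_iUnion_of_finite
    (fun _ => Set.toFinite _) ?_, finsum_eq_sum_of_fintype, numAttached]
  · refine fun i j hij => Set.disjoint_left.2 ?_
    rintro t ⟨-, -, hi, -⟩ ⟨-, -, hj, -⟩
    exact hij (hinj ((hchild i).eq_of_reflTransGen (hchild j)
      hi.to_reflTransGen hj.to_reflTransGen))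
  · rw [Set.disjoint_left]
    rintro t ht ⟨hwt, -, -⟩
    obtain ⟨i, -, -, hut, -⟩ := Set.mem_iUnion.1 ht
    obtain rfl := (hchild i).eq_of_reflTransGen hwt hut.to_reflTransGen .refl
    exact not_transGen_child_self hut

end IsRun

theorem IsStep.range_argument {m k d : ℕ} {rank : Fin m → ℕ} {r : VATARule rank k d}
    (h : IsStep r w) {u : Fin (rank r.symbol) → T.dom} (hinj : Function.Injective u)
    (hu : ∀ i, T.Child w (u i) ∧ Run (u i)) : Set.range u = {u | T.Child w u ∧ Run u} := by
  refine Set.eq_of_subset_of_ncard_le (Set.range_subset_iff.2 hu) ?_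
  rw [h.arity, ← Set.image_univ, Set.ncard_image_of_injective _ hinj, Set.ncard_univ, Nat.card_fin]

namespace IsRun

theorem exists_reaches (hT : IsRun A T) (hw : Run w) : ∃ t q,
    A.Reaches t q (fun c => (carried (c + 2) w).ncard) ∧ numAttached 1 w = q := by
  induction w using wellFounded_swap_child.induction with
  | _ w ih =>
  obtain ⟨r, hr, hstep⟩ := hT.step hw
  choose u hu hrun hstate hloss using hstep.argument
  have hinj : Function.Injective u := fun i j hij => by
    simpa [hu, Fin.ext_iff] using congrArg Subtype.val hij
  have hchild (i) : T.Child w (u i) := ⟨i, hu i⟩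
  choose ts qs hreach hq using fun i => ih (u i) (hchild i) (hrun i)
  obtain rfl : qs = r.source := funext fun i => Fin.ext ((hq i).symm.trans (hstate i))
  refine ⟨.node r.symbol ts, r.target, ?_, hstep.target⟩
  have hcarried (c : Fin A.dim) (i) :
      (carried (c + 2) (u i)).ncard = (passedOn (c + 2) (u i)).ncard + r.loss i c := by
    rw [hT.ncard_carried, hloss]
  convert VATA.Reaches.step r hr ts (fun i c => (carried (c + 2) (u i)).ncard) hreach
    (fun i c => (hcarried c i).ge.trans' (Nat.le_add_left _ _)) using 2 with c
  simp only [hcarried, Nat.add_sub_cancel]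
  rw [hT.ncard_carried_eq_sum hinj (hstep.range_argument hinj fun i => ⟨hchild i, hrun i⟩),
    hstep.gain]

theorem nonEmpty (hT : IsRun A T) : A.NonEmpty := by
  obtain ⟨w, hw, hroot, a, ha, hstate, hconsumed⟩ := hT.accept
  obtain ⟨t, q, hreach, hq⟩ := hT.exists_reaches hw
  obtain rfl : q = a.1 := Fin.ext (hq.symm.trans hstate)
  have hpassedOn (s : ℕ) : passedOn s w = ∅ := by
    refine Set.eq_empty_of_forall_notMem ?_
    rintro t ⟨-, -, -, v, -, hvw⟩
    obtain ⟨u, -, hu⟩ := Relation.TransGen.tail'_iff.1 hvw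
    exact hroot ⟨u, hu⟩
  have hcarried : (fun c : Fin A.dim => (carried (c + 2) w).ncard) = a.2 := by
    funext c
    rw [hT.ncard_carried, hpassedOn, Set.ncard_empty, zero_add, hconsumed]
  exact ⟨t, a, ha, hcarried ▸ hreach⟩

end IsRun

end TreeStructure

/-! ## Completeness -/

/-- What a leaf stands for: a leaf attached to a run node is one unit of its state, consumed at that
node, or one token of the counter `c`, consumed `h` levels higher. -/
inductive Leaf (d : ℕ) : Type where
  | state : Leaf d
  | token (c : Fin d) (h : ℕ) : Leaf d
  deriving DecidableEq

namespace Leaf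

variable {d : ℕ}

/-- The number of levels between the run node a leaf is attached to and the one consuming it. -/
def height : Leaf d → ℕ
  | state => 0
  | token _ h => h

/-- The unary symbol of a leaf. -/
def kind : Leaf d → ℕ
  | state => 1
  | token c _ => c + 2

theorem kind_ne_zero (a : Leaf d) : a.kind ≠ 0 := by
  cases a <;> simp [kind]

theorem kind_eq_add_two {a : Leaf d} {c : Fin d} : a.kind = c + 2 ↔ a = token c a.height := by
  cases a <;> simp [kind, height, Fin.ext_iff]

end Leaf

/-- A node of a run, labelled as a run node or as a leaf. -/
inductive NodeLabel (d : ℕ) : Type where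
  | run : NodeLabel d
  | leaf (a : Leaf d) : NodeLabel d

/-- The unary symbol of a node. -/
def NodeLabel.kind {d : ℕ} : NodeLabel d → ℕ
  | run => 0
  | leaf a => a.kind

/-- A partial labelling of the positions of the infinite tree; it represents a tree with labelled
nodes if its domain is a tree domain. -/
def Labelling (d : ℕ) : Type := List ℕ → Option (NodeLabel d)

namespace Labelling

open NodeLabel

variable {d : ℕ} {L : Labelling d} {p : List ℕ} {s h : ℕ} {c : Fin d} {a : Leaf d}

/-- The labelling of the subtree at `p`. -/
def subtree (L : Labelling d) (p : List ℕ) : Labelling d := fun q => L (p ++ q)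

/-- The leaves of kind `s` attached to the root. -/
def attached (L : Labelling d) (s : ℕ) : Set (List ℕ) :=
  {q | q.length = 1 ∧ (L q).map kind = some s}

/-- The tokens of the counter `c` to be consumed `h` levels above the root. -/
def pending (L : Labelling d) (c : Fin d) (h : ℕ) : Set (List ℕ) :=
  {q | ∃ k, L q = some (leaf (.token c k)) ∧ k + 1 = q.length + h}

/-- The labelling represents a finite tree in which only run nodes have children. -/
structure IsTree (L : Labelling d) : Prop where
  finite : {p | L p ≠ none}.Finite
  root : L [] ≠ none
  parent (p : List ℕ) (i : ℕ) : L (p ++ [i]) ≠ none → L p = some run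
  left (p : List ℕ) (i : ℕ) : L (p ++ [i + 1]) ≠ none → L (p ++ [i]) ≠ none

/-- The root represents an application of the rule `r`. -/
structure IsStep {m k : ℕ} {rank : Fin m → ℕ} (r : VATARule rank k d) (L : Labelling d) :
    Prop where
  run_iff (j : ℕ) : L [j] = some run ↔ j < rank r.symbol
  source (i : Fin (rank r.symbol)) : (attached (subtree L [i.1]) 1).ncard = r.source i
  loss (i : Fin (rank r.symbol)) (c : Fin d) : (pending (subtree L [i.1]) c 0).ncard = r.loss i c
  target : (attached L 1).ncard = r.target
  gain (c : Fin d) : (attached L (c + 2)).ncard = r.gain c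

/-- The labelling represents a run of `A`, possibly with tokens to be consumed above the root. -/
structure IsRun (A : VATA) (L : Labelling A.dim) : Prop extends IsTree L where
  root_eq : L [] = some run
  step (p : List ℕ) : L p = some run → ∃ r ∈ A.rules, IsStep r (subtree L p)

theorem IsTree.finite_pending (hL : IsTree L) : (pending L c h).Finite :=
  hL.finite.subset fun _ ⟨_, hq, _⟩ => by simp [hq]

/-- The tree consisting of a leaf. -/
def single (a : Leaf d) : Labelling d
  | [] => some (leaf a)
  | _ :: _ => none

theorem isTree_single : IsTree (single a) where
  finite := (Set.finite_singleton []).subset fun p hp => by cases p <;> simp_all [single]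
  root := by simp [single]
  parent p i := by cases p <;> simp [single]
  left p i := by cases p <;> simp [single]

theorem ncard_pending_single :
    (pending (single a) c (h + 1)).ncard = if a = .token c h then 1 else 0 := by
  split_ifs with ha
  · refine Set.ncard_eq_one.2 ⟨[], Set.ext fun q => ?_⟩
    cases q <;> simp [pending, single, ha]
  · rw [Set.ncard_eq_zero isTree_single.finite_pending]
    refine Set.eq_empty_of_forall_notMem ?_
    rintro (_ | ⟨j, q⟩) ⟨k, hq, hk⟩
    · simp_all [single]
    · simp [single] at hq

/-- The tree with the given subtrees below a run node. -/
def glue (l : List (Labelling d)) : Labelling d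
  | [] => some run
  | j :: q => l[j]?.bind fun L => L q

variable {l : List (Labelling d)}

theorem glue_cons_getElem (j : Fin l.length) (q : List ℕ) : glue l (j :: q) = l[j] q := by
  simp [glue]

theorem lt_length_of_glue_ne_none {j : ℕ} {q : List ℕ} (hjq : glue l (j :: q) ≠ none) :
    j < l.length := by
  contrapose! hjq
  simp [glue, hjq]

theorem isTree_glue (hl : ∀ L ∈ l, IsTree L) : IsTree (glue l) where
  finite := by
    refine ((Set.finite_singleton []).union (Set.finite_iUnion fun j : Fin l.length =>
      (hl l[j] (List.getElem_mem _)).finite.image (List.cons j.1))).subset ?_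
    rintro (_ | ⟨j, q⟩) hq
    · exact .inl rfl
    · lift j to Fin l.length using lt_length_of_glue_ne_none hq
      exact .inr (Set.mem_iUnion.2 ⟨j, q, by simpa [glue_cons_getElem] using hq, rfl⟩)
  root := by simp [glue]
  parent := by
    rintro (_ | ⟨j, p⟩) i hi
    · rfl
    · lift j to Fin l.length using lt_length_of_glue_ne_none hi
      rw [List.cons_append, glue_cons_getElem] at hi
      rw [glue_cons_getElem]
      exact (hl _ (List.getElem_mem _)).parent p i hi
  left := by
    rintro (_ | ⟨j, p⟩) i hi
    · have hi' : i < l.length := i.lt_succ_self.trans (lt_length_of_glue_ne_none hi)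
      exact (glue_cons_getElem ⟨i, hi'⟩ []).trans_ne (hl _ (List.getElem_mem _)).root
    · lift j to Fin l.length using lt_length_of_glue_ne_none hi
      rw [List.cons_append, glue_cons_getElem] at hi ⊢
      exact (hl _ (List.getElem_mem _)).left p i hi

theorem ncard_iUnion_image_cons {n : ℕ} {X : Fin n → Set (List ℕ)} (hX : ∀ i, (X i).Finite) :
    (⋃ i, List.cons i.1 '' X i).ncard = ∑ i, (X i).ncard := by
  rw [Set.ncard_iUnion_of_finite (fun i => (hX i).image _), finsum_eq_sum_of_fintype]
  · exact Finset.sum_congr rfl fun i _ => Set.ncard_image_of_injective _ List.cons_injective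
  · refine fun i j hij => Set.disjoint_left.2 ?_
    rintro _ ⟨q, -, rfl⟩ ⟨q', -, heq⟩
    exact hij (Fin.ext (List.cons.inj heq).1.symm)

theorem ncard_attached_glue :
    (attached (glue l) s).ncard = l.countP fun L => (L []).map kind = some s := by
  have hunion : attached (glue l) s = ⋃ j : Fin l.length,
      List.cons j.1 '' {q | q = [] ∧ (l[j] []).map kind = some s} := by
    ext q
    simp only [Set.mem_iUnion]
    constructor
    · rintro ⟨hlength, hq⟩
      obtain ⟨j, rfl⟩ := List.length_eq_one_iff.1 hlength
      lift j to Fin l.length using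
        lt_length_of_glue_ne_none (q := []) fun hnone => by simp [hnone] at hq
      exact ⟨j, [], ⟨rfl, by rwa [glue_cons_getElem] at hq⟩, rfl⟩
    · rintro ⟨j, _, ⟨rfl, hj⟩, rfl⟩
      exact ⟨rfl, by rwa [glue_cons_getElem]⟩
  have hncard (L : Labelling d) : {q : List ℕ | q = [] ∧ (L []).map kind = some s}.ncard =
      if (L []).map kind = some s then 1 else 0 := by
    split_ifs with hL <;> simp [hL]
  rw [hunion, ncard_iUnion_image_cons fun j => (Set.finite_singleton []).subset fun q hq => hq.1]
  simp only [hncard]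
  refine (Fin.sum_univ_fun_getElem l fun L => if (L []).map kind = some s then 1 else 0).trans ?_
  simp [List.countP_eq_length_filter, List.sum_map_ite]

theorem ncard_pending_glue (hl : ∀ L ∈ l, IsTree L) :
    (pending (glue l) c h).ncard = (l.map fun L => (pending L c (h + 1)).ncard).sum := by
  have hunion : pending (glue l) c h =
      ⋃ j : Fin l.length, List.cons j.1 '' pending l[j] c (h + 1) := by
    ext q
    simp only [Set.mem_iUnion]
    constructor
    · rintro ⟨k, hq, hk⟩
      obtain _ | ⟨j, q⟩ := q
      · simp [glue] at hq
      · lift j to Fin l.length using lt_length_of_glue_ne_none (q := q) (by simp [hq])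
        refine ⟨j, q, ⟨k, by rwa [glue_cons_getElem] at hq, ?_⟩, rfl⟩
        rw [hk, List.length_cons, add_right_comm, add_assoc]
    · rintro ⟨j, q, ⟨k, hq, hk⟩, rfl⟩
      refine ⟨k, by rwa [glue_cons_getElem], ?_⟩
      rw [hk, List.length_cons, add_right_comm, add_assoc]
  rw [hunion]
  refine (ncard_iUnion_image_cons fun j => (hl _ (List.getElem_mem _)).finite_pending).trans ?_
  exact Fin.sum_univ_fun_getElem l fun L => (pending L c (h + 1)).ncard

/-- The subtrees below a run node: those of the arguments, followed by the leaves attached to it. -/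
def children {n : ℕ} (K : Fin n → Labelling d) (l : List (Leaf d)) : List (Labelling d) :=
  List.ofFn K ++ l.map single

section children

variable {n : ℕ} {K : Fin n → Labelling d} {l : List (Leaf d)}

theorem isTree_of_mem_children (hK : ∀ i, IsTree (K i)) : ∀ L ∈ children K l, IsTree L := by
  simp only [children, List.mem_append, List.mem_ofFn, List.mem_map]
  rintro _ (⟨i, rfl⟩ | ⟨a, -, rfl⟩)
  exacts [hK i, isTree_single]

theorem subtree_glue_children (i : Fin n) : subtree (glue (children K l)) [i.1] = K i := by
  funext q
  simp [subtree, glue, children, List.getElem?_append_left]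

theorem glue_children_eq_run_iff (hK : ∀ i, K i [] = some run) (j : ℕ) :
    glue (children K l) [j] = some run ↔ j < n := by
  obtain hj | hj := lt_or_ge j n
  · simp [glue, children, List.getElem?_append_left, hj, hK]
  · rcases hleaf : l[j - n]? <;>
      simp [glue, children, List.getElem?_append_right, hj, single, hleaf]

theorem ncard_attached_glue_children (hK : ∀ i, K i [] = some run) (hs : s ≠ 0) :
    (attached (glue (children K l)) s).ncard = l.countP fun a => a.kind = s := by
  have hargument : (List.ofFn K).countP (fun L => (L []).map kind = some s) = 0 := by
    simp [List.countP_eq_zero, List.mem_ofFn, hK, kind, hs.symm]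
  rw [ncard_attached_glue, children, List.countP_append, hargument, zero_add, List.countP_map]
  simp [Function.comp_def, single, kind]

theorem ncard_pending_glue_children (hK : ∀ i, IsTree (K i)) :
    (pending (glue (children K l)) c h).ncard =
      ∑ i, (pending (K i) c (h + 1)).ncard + l.countP fun a => a = .token c h := by
  rw [ncard_pending_glue (isTree_of_mem_children hK), children, List.map_append, List.sum_append,
    List.map_ofFn, List.sum_ofFn, List.map_map]
  congr 1
  simp [Function.comp_def, ncard_pending_single, List.sum_map_ite, List.countP_eq_length_filter]

theorem isStep_glue_children {m k : ℕ} {rank : Fin m → ℕ} {r : VATARule rank k d}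
    {K : Fin (rank r.symbol) → Labelling d} (hK : ∀ i, K i [] = some run)
    (hsource : ∀ i, (attached (K i) 1).ncard = r.source i)
    (hloss : ∀ i c, (pending (K i) c 0).ncard = r.loss i c)
    (htarget : (l.countP fun a => a.kind = 1) = r.target)
    (hgain : ∀ c : Fin d, (l.countP fun a => a.kind = (c : ℕ) + 2) = r.gain c) :
    IsStep r (glue (children K l)) where
  run_iff := glue_children_eq_run_iff hK
  source i := by rw [subtree_glue_children, hsource]
  loss i c := by rw [subtree_glue_children, hloss]
  target := by rw [ncard_attached_glue_children hK one_ne_zero, htarget]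
  gain c := by rw [ncard_attached_glue_children hK (Nat.succ_ne_zero _), hgain]

theorem isRun_glue_children {A : VATA} {K : Fin n → Labelling A.dim} {l : List (Leaf A.dim)}
    {r : VATARule A.rank A.numStates A.dim} (hr : r ∈ A.rules) (hK : ∀ i, IsRun A (K i))
    (hstep : IsStep r (glue (children K l))) : IsRun A (glue (children K l)) where
  toIsTree := isTree_glue (isTree_of_mem_children fun i => (hK i).toIsTree)
  root_eq := rfl
  step := by
    rintro (_ | ⟨j, p⟩) hp
    · exact ⟨r, hr, hstep⟩
    · lift j to Fin (children K l).length using lt_length_of_glue_ne_none (q := p) (by simp [hp])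
      have hsubtree : subtree (glue (children K l)) (j :: p) = subtree (children K l)[j] p :=
        funext fun q => glue_cons_getElem j (p ++ q)
      rw [hsubtree]
      rw [glue_cons_getElem] at hp
      have hmem : (children K l)[j] ∈ children K l := List.getElem_mem _
      generalize (children K l)[j] = L at hp hmem
      simp only [children, List.mem_append, List.mem_ofFn, List.mem_map] at hmem
      obtain ⟨i, rfl⟩ | ⟨a, -, rfl⟩ := hmem
      · exact (hK i).step p hp
      · cases p <;> simp [single] at hp

end children

/-- `q` leaves for the state and, for each counter `c`, a token for every height in `G c`. -/
noncomputable def newLeaves (q : ℕ) (G : Fin d → Multiset ℕ) : List (Leaf d) :=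
  List.replicate q .state ++ (List.finRange d).flatMap fun c => (G c).toList.map (.token c)

section newLeaves

variable {q : ℕ} {G : Fin d → Multiset ℕ}

theorem countP_newLeaves (P : Leaf d → Prop) [DecidablePred P] :
    (newLeaves q G).countP P =
      (if P .state then q else 0) + ∑ c, (G c).countP fun h => P (.token c h) := by
  rw [newLeaves, List.countP_append, List.countP_replicate, List.countP_flatMap,
    ← List.ofFn_eq_map, List.sum_ofFn]
  simp only [Function.comp_def, List.countP_map, decide_eq_true_eq, ← Multiset.coe_countP,
    Multiset.coe_toList]

theorem countP_kind_eq_one_newLeaves : ((newLeaves q G).countP fun a => a.kind = 1) = q := by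
  rw [countP_newLeaves]
  simp [Leaf.kind]

theorem countP_kind_eq_add_two_newLeaves :
    ((newLeaves q G).countP fun a => a.kind = (c : ℕ) + 2) = (G c).card := by
  rw [countP_newLeaves, Finset.sum_eq_single_of_mem c (Finset.mem_univ c)]
  · simp [Leaf.kind]
  · simp +contextual [Leaf.kind, Fin.val_inj]

theorem countP_eq_token_newLeaves :
    ((newLeaves q G).countP fun a => a = .token c h) = (G c).count h := by
  rw [countP_newLeaves, Finset.sum_eq_single_of_mem c (Finset.mem_univ c)]
  · simp [Multiset.count, eq_comm]
  · simp +contextual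

end newLeaves

theorem exists_multiset_split {α : Type} {n : ℕ} (a : Fin n → ℕ) {H : Multiset α}
    (hH : ∑ i, a i ≤ H.card) :
    ∃ (P : Fin n → Multiset α) (G : Multiset α), H = ∑ i, P i + G ∧ ∀ i, (P i).card = a i := by
  induction n generalizing H with
  | zero => exact ⟨Fin.elim0, H, by simp, fun i => i.elim0⟩
  | succ n ih =>
    rw [Fin.sum_univ_succ] at hH
    obtain ⟨P₀, hP₀⟩ := Multiset.card_pos_iff_exists_mem.1
      (Multiset.card_powersetCard (a 0) H ▸ Nat.choose_pos (le_of_add_le_left hH))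
    obtain ⟨hle, hcard⟩ := Multiset.mem_powersetCard.1 hP₀
    obtain ⟨H', rfl⟩ := Multiset.le_iff_exists_add.1 hle
    obtain ⟨P, G, rfl, hP⟩ := ih (fun i => a i.succ) (H := H')
      (by rwa [Multiset.card_add, hcard, add_le_add_iff_left] at hH)
    exact ⟨Fin.cons P₀ P, G, by simp [Fin.sum_univ_succ, add_assoc],
      Fin.cases (by simpa using hcard) (by simpa using hP)⟩

theorem exists_schedule {n g : ℕ} {x l : Fin n → ℕ} (hl : ∀ i, l i ≤ x i) {H : Multiset ℕ}
    (hH : H.card = ∑ i, (x i - l i) + g) : ∃ (J : Fin n → Multiset ℕ) (G : Multiset ℕ),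
      G.card = g ∧ (∀ i, (J i).card = x i) ∧ (∀ i, (J i).count 0 = l i) ∧
        ∀ h, ∑ i, (J i).count (h + 1) + G.count h = H.count h := by
  obtain ⟨P, G, rfl, hP⟩ := exists_multiset_split (fun i => x i - l i)
    (hH.ge.trans' (Nat.le_add_right _ _))
  refine ⟨fun i => (P i).map (· + 1) + .replicate (l i) 0, G, ?_, fun i => ?_, fun i => ?_,
    fun h => ?_⟩
  · simpa [hP] using hH
  · simp [hP, hl]
  · simp
  · simp [Multiset.count_sum', Multiset.count_map_eq_count' _ _ (add_left_injective 1),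
      Multiset.count_replicate]

theorem exists_isRun {A : VATA} {t : RankedTerm A.rank} {q : Fin A.numStates} {x : Fin A.dim → ℕ}
    (ht : A.Reaches t q x) {H : Fin A.dim → Multiset ℕ} (hH : ∀ c, (H c).card = x c) :
    ∃ L, IsRun A L ∧ (attached L 1).ncard = q ∧ ∀ c h, (pending L c h).ncard = (H c).count h := by
  induction ht generalizing H with
  | step r hr _ xs _ hloss ih =>
    choose J G hG hJ hJloss hJH using fun c => exists_schedule (fun i => hloss i c) (hH c)
    choose K hK hsource hpending using fun i => ih i (H := fun c => J c i) fun c => hJ c i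
    have hroot (i) : K i [] = some run := (hK i).root_eq
    have hstep : IsStep r (glue (children K (newLeaves r.target G))) :=
      isStep_glue_children hroot hsource (fun i c => by rw [hpending, hJloss])
        countP_kind_eq_one_newLeaves
        fun c => by rw [countP_kind_eq_add_two_newLeaves, hG]
    refine ⟨_, isRun_glue_children hr hK hstep, hstep.target, fun c h => ?_⟩
    simp only [ncard_pending_glue_children fun i => (hK i).toIsTree, hpending,
      countP_eq_token_newLeaves, hJH]

end Labelling

theorem TreeStructure.mem_dom_of_append {T : TreeStructure} {p q : List ℕ}
    (hpq : p ++ q ∈ T.dom) : p ∈ T.dom := by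
  induction q using List.reverseRecOn with
  | nil => rwa [List.append_nil] at hpq
  | append_singleton q i ih => exact ih (T.parent_mem _ i (by rwa [List.append_assoc]))

namespace Labelling

open NodeLabel

variable {d : ℕ} {L : Labelling d} {s : ℕ}

/-- The tree of a labelling, in which a leaf `u` is consumed at the node `w` whose distance to `u`
is determined by the height of the leaf. -/
noncomputable def IsTree.tree (hL : IsTree L) : TreeStructure where
  dom := hL.finite.toFinset
  root_mem := by simpa using hL.root
  parent_mem u i hi := by
    simp only [Set.Finite.mem_toFinset, Set.mem_ofPred_eq] at hi ⊢
    simp [hL.parent u i hi]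
  left_mem u i := by simpa using hL.left u i
  unary s u := (L u).map kind = some s
  common _ u w := ∃ a q, L u = some (leaf a) ∧ u = w.1 ++ q ∧ q.length = a.height + 1

namespace IsTree

variable {hL : IsTree L} {u : hL.tree.dom}

theorem mem_dom_tree {p : List ℕ} : p ∈ hL.tree.dom ↔ L p ≠ none := by
  simp [tree]

theorem run_iff : TreeStructure.Run u ↔ L u = some run := by
  change (L u).map kind = some 0 ↔ _
  rcases L u with _ | _ | a <;> simp [kind, Leaf.kind_ne_zero]

theorem ncard_eq_of_forall_mem_iff (u : hL.tree.dom) {S : Set hL.tree.dom} {X : Set (List ℕ)}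
    (hX : ∀ q ∈ X, subtree L u q ≠ none) (hS : ∀ t, t ∈ S ↔ ∃ q ∈ X, t.1 = u.1 ++ q) :
    S.ncard = X.ncard := by
  rw [← Set.ncard_image_of_injective S Subtype.val_injective,
    ← Set.ncard_image_of_injective X (List.append_right_injective u.1)]
  congr 1
  ext p
  constructor
  · rintro ⟨t, ht, rfl⟩
    obtain ⟨q, hq, ht⟩ := (hS t).1 ht
    exact ⟨q, hq, ht.symm⟩
  · rintro ⟨q, hq, rfl⟩
    exact ⟨⟨u.1 ++ q, mem_dom_tree.2 (hX q hq)⟩, (hS _).2 ⟨q, hq, rfl⟩, rfl⟩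

theorem numAttached_eq (hs : s ≠ 0) :
    TreeStructure.numAttached s u = (attached (subtree L u) s).ncard := by
  refine ncard_eq_of_forall_mem_iff u (fun q hq hnone => by simpa [hnone] using hq.2) fun t => ?_
  constructor
  · rintro ⟨⟨i, hi⟩, -, ht⟩
    exact ⟨[i], ⟨rfl, by rwa [subtree, ← hi]⟩, hi⟩
  · rintro ⟨q, ⟨hlength, hq⟩, ht⟩
    obtain ⟨i, rfl⟩ := List.length_eq_one_iff.1 hlength
    have hkind : (L t).map kind = some s := ht ▸ hq
    refine ⟨⟨i, ht⟩, fun hrun => hs ?_, hkind⟩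
    simpa [run_iff.1 hrun, kind, eq_comm] using hkind

theorem numConsumed_eq {c : Fin d} :
    TreeStructure.numConsumed (c + 2) u = (pending (subtree L u) c 0).ncard := by
  refine ncard_eq_of_forall_mem_iff u (fun q ⟨_, hq, _⟩ => by simp [hq]) fun t => ?_
  constructor
  · rintro ⟨⟨a, q, ha, ht, hq⟩, hkind⟩
    have ha' : a = .token c a.height := by
      rw [← Leaf.kind_eq_add_two]
      simpa [tree, ha, kind] using hkind
    exact ⟨q, ⟨a.height, by rwa [subtree, ← ht, ← ha'], hq.symm⟩, ht⟩
  · rintro ⟨q, ⟨k, hq, hk⟩, ht⟩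
    have htoken : L t = some (leaf (.token c k)) := ht ▸ hq
    exact ⟨⟨_, q, htoken, ht, hk.symm⟩, by simp [tree, htoken, kind, Leaf.kind]⟩

theorem isStep {m k : ℕ} {rank : Fin m → ℕ} {r : VATARule rank k d}
    (h : IsStep r (subtree L u)) : TreeStructure.IsStep r u := by
  have hrun (j : ℕ) : L (u.1 ++ [j]) = some run ↔ j < rank r.symbol := h.run_iff j
  refine ⟨?_, fun i => ?_, ?_, fun c => ?_⟩
  · rw [ncard_eq_of_forall_mem_iff u (X := (fun j => [j]) '' Set.Iio (rank r.symbol)),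
      Set.ncard_image_of_injective _ List.singleton_injective, Set.ncard_Iio_nat]
    · rintro _ ⟨j, hj, rfl⟩
      simp [subtree, (hrun j).2 hj]
    · refine fun t => ⟨?_, ?_⟩
      · rintro ⟨⟨j, hj⟩, ht⟩
        exact ⟨[j], ⟨j, (hrun j).1 (hj ▸ run_iff.1 ht), rfl⟩, hj⟩
      · rintro ⟨_, ⟨j, hj, rfl⟩, ht⟩
        exact ⟨⟨j, ht⟩, run_iff.2 (ht ▸ (hrun j).2 hj)⟩
  · have hi : L (u.1 ++ [i.1]) = some run := (hrun i).2 i.2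
    have hsubtree : subtree L (u.1 ++ [i.1]) = subtree (subtree L u) [i.1] :=
      funext fun q => congrArg L (List.append_assoc _ _ _)
    refine ⟨⟨u.1 ++ [i.1], mem_dom_tree.2 (by simp [hi])⟩, rfl, run_iff.2 hi, ?_, fun c => ?_⟩
    · rw [numAttached_eq one_ne_zero, hsubtree, h.source]
    · rw [numConsumed_eq, hsubtree, h.loss]
  · rw [numAttached_eq one_ne_zero, h.target]
  · rw [numAttached_eq (Nat.succ_ne_zero _), h.gain]

theorem ncard_consumers (hrun : ¬ TreeStructure.Run u)
    (hheight : ∀ p a, L p = some (leaf a) → a.height < p.length) :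
    {w | hL.tree.common 0 u w}.ncard = 1 := by
  obtain ⟨a, ha⟩ : ∃ a, L u = some (leaf a) := by
    rw [run_iff] at hrun
    rcases hu : L u with _ | _ | a
    · exact (mem_dom_tree.1 u.2 hu).elim
    · exact (hrun hu).elim
    · exact ⟨a, rfl⟩
  let p : List ℕ := u.1.take (u.1.length - (a.height + 1))
  have hp : p ++ u.1.drop (u.1.length - (a.height + 1)) = u.1 := List.take_append_drop _ _
  refine Set.ncard_eq_one.2 ⟨⟨p, TreeStructure.mem_dom_of_append (hp ▸ u.2)⟩, Set.ext fun w => ?_⟩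
  constructor
  · rintro ⟨a', q, ha', hu, hq⟩
    obtain rfl : a = a' := by simpa [ha] using ha'
    refine Subtype.ext (List.append_inj_left' (hu.symm.trans hp.symm) ?_)
    rw [hq, List.length_drop, Nat.sub_sub_self (hheight u a ha)]
  · rintro rfl
    exact ⟨a, _, ha, hp.symm, by rw [List.length_drop, Nat.sub_sub_self (hheight u a ha)]⟩

end IsTree

theorem height_lt_length (hroot : L [] = some run)
    (hpending : ∀ c h, pending L c (h + 1) = ∅) {p : List ℕ} {a : Leaf d}
    (ha : L p = some (leaf a)) : a.height < p.length := by
  cases a with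
  | state =>
    refine List.length_pos_iff.2 ?_
    rintro rfl
    simp [hroot] at ha
  | token c k =>
    by_contra! hk
    obtain ⟨h, rfl⟩ := Nat.exists_eq_add_of_le hk
    exact (hpending c h).subset ⟨_, ha, add_assoc _ _ _⟩

theorem IsRun.isRun_tree {A : VATA} {L : Labelling A.dim} (hL : IsRun A L)
    {a : Fin A.numStates × (Fin A.dim → ℕ)} (ha : a ∈ A.accepting)
    (hstate : (attached L 1).ncard = a.1) (hcounter : ∀ c, (pending L c 0).ncard = a.2 c)
    (hpending : ∀ c h, pending L c (h + 1) = ∅) : TreeStructure.IsRun A hL.tree where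
  run_of_child := by
    rintro u w ⟨i, hi⟩
    exact IsTree.run_iff.2 (hL.parent u i (hi ▸ IsTree.mem_dom_tree.1 w.2))
  desc_of_consumed := by
    rintro u w ⟨a, q, hu, huw, hq⟩
    refine ⟨by simp [IsTree.run_iff, hu], TreeStructure.transGen_child_iff.2 ⟨⟨q, huw.symm⟩, ?_⟩⟩
    rintro rfl
    simp [List.self_eq_append_right.1 huw] at hq
  consumed_once hu :=
    IsTree.ncard_consumers hu fun _ _ => height_lt_length hL.root_eq hpending
  step {u} hu := by
    obtain ⟨r, hr, hstep⟩ := hL.step u (IsTree.run_iff.1 hu)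
    exact ⟨r, hr, IsTree.isStep hstep⟩
  accept := by
    refine ⟨⟨[], hL.tree.root_mem⟩, IsTree.run_iff.2 hL.root_eq, ?_, a, ha, ?_, fun c => ?_⟩
    · rintro ⟨w, i, hi⟩
      simp at hi
    · rw [IsTree.numAttached_eq one_ne_zero]
      exact hstate
    · rw [IsTree.numConsumed_eq]
      exact hcounter c

end Labelling

theorem VATA.nonEmpty_iff_satisfiable (A : VATA) : A.NonEmpty ↔ A.sentence.Satisfiable := by
  constructor
  · rintro ⟨t, a, ha, ht⟩
    obtain ⟨L, hL, hstate, hpending⟩ := Labelling.exists_isRun ht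
      (H := fun c => .replicate (a.2 c) 0) fun c => Multiset.card_replicate _ _
    have hrun : TreeStructure.IsRun A hL.tree :=
      hL.isRun_tree ha hstate (fun c => by rw [hpending, Multiset.count_replicate_self]) fun c h =>
        (Set.ncard_eq_zero hL.finite_pending).1
          (by rw [hpending, Multiset.count_replicate, if_neg h.succ_ne_zero.symm])
    exact ⟨hL.tree, fun _ => TreeStructure.sat_formula.2 hrun⟩
  · rintro ⟨T, hT⟩
    exact (TreeStructure.sat_formula.1 (hT fun _ => ⟨[], T.root_mem⟩)).nonEmpty

theorem theorem7 :
    PolyTimeReducible VATA.encode C2Sentence.encode VATA.NonEmpty C2Sentence.Satisfiable :=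
  ⟨VATA.sentence, VATA.polyTimeComputable_sentence, VATA.nonEmpty_iff_satisfiable⟩
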